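/- A network is a finite undirected multigraph $G=(V,E)$ with a non-negative rational cost $c_e$ and a non-negative rational capacity $u_e$ on every edge $e$, and with two distinct designated vertices, the source $s$ and the sink $t$. For $F\subseteq E$ let $c(F)=\sum_{e\in F}c_e$. An $s$-$t$ flow in $(V,F)$ assigns to every edge $e\in F$ a direction and a real amount between $0$ and $u_e$ such that at every vertex other than $s$ and $t$ the total amount entering equals the total amount leaving; its value is the amount leaving $s$ minus the amount entering $s$, and $\mathrm{maxflow}(F)$ is the maximum value of an $s$-$t$ flow in $(V,F)$. BCMFP: given a network and a budget $B\in\mathbb{Q}_{\ge 0}$, find a set $F\subseteq E$ with $c(F)\le B$ for which $\mathrm{maxflow}(F)$ is maximum. CapNDP: given a network and a demand $D\in\mathbb{Q}_{\ge 0}$, find a set $F\subseteq E$ of minimum cost $c(F)$ with $\mathrm{maxflow}(F)\ge D$, or report that there is none. A graph is series-parallel with terminals $a\ne b$ if it is a single edge joining $a$ and $b$, or arises from two disjoint series-parallel graphs with terminals $a_1,b_1$ and $a_2,b_2$ either by identifying $b_1$ with $a_2$ (new terminals $a_1,b_2$) or by identifying $a_1$ with $a_2$ and $b_1$ with $b_2$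 (new terminals $a_1,b_1$). The source and the sink of a network need not be the terminals. Theorem 3. Let $k\ge 0$ be a constant and let $p$ be a polynomial with coefficients in $\mathbb{N}$. Consider the instances of BCMFP, respectively of CapNDP, in which the graph is series-parallel and in which there are a natural number $K\le p(\text{size})$, where size is the length of the binary encoding of the instance, and real numbers $d_1,\dots,d_k$ such that every edge capacity lies in $\{\sum_{i=1}^k\alpha_i d_i:\alpha_i\in\mathbb{Z},\ |\alpha_i|\le K\}$. Then BCMFP and CapNDP restricted to these instances are solvable in polynomial time: for each of the two problems there are an algorithm and a polynomial $q$ such that on every such instance the algorithm, given only the network (as a list of edges with endpoints, costs and capacities, together with $s$ and $t$) and the number $B$, respectively $D$, outputs an optimal set of edges (or, for CapNDP, reports that no set of edges meets the demand) after at most $q(\text{size})$ steps. -/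

import Mathlib

/-! ### A machine model with a step count

Data are binary trees whose leaves are integers written in binary.  Programs are built from the
usual tree and integer operations by composition, pairing, branching and while-loops.  Every step
is charged the bit size of the data it reads and writes, so that polynomial time in this model is
ordinary (Turing machine) polynomial time. -/

/-- Data of the machine: an integer or a pair. -/
inductive Val where
  | num (z : ℤ) : Val
  | pair (a b : Val) : Val

/-- Bit size: an integer takes its binary length, with one more unit for each node of the tree. -/
def Val.size : Val → ℕ
  | .num z => z.natAbs.size + 1
  | .pair a b => a.size + b.size + 1

/-- The elementary operations. -/
inductive Prim where
  | id
  | const (z : ℤ)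
  | fst
  | snd
  | isPair
  | add
  | sub
  | mul
  | le

/-- The effect of an elementary operation; on data of the wrong shape the result is `0`. -/
def Prim.apply : Prim → Val → Val
  | .id, v => v
  | .const z, _ => .num z
  | .fst, .pair a _ => a
  | .snd, .pair _ b => b
  | .isPair, .pair _ _ => .num 1
  | .add, .pair (.num x) (.num y) => .num (x + y)
  | .sub, .pair (.num x) (.num y) => .num (x - y)
  | .mul, .pair (.num x) (.num y) => .num (x * y)
  | .le, .pair (.num x) (.num y) => .num (if x ≤ y then 1 else 0)
  | _, _ => .num 0

/-- Programs. -/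
inductive Prog where
  /-- perform an elementary operation on the current datum -/
  | prim (o : Prim) : Prog
  /-- first `f`, then `g` on the result -/
  | comp (g f : Prog) : Prog
  /-- run `f` and `g` on the same datum and pair the results -/
  | pair (f g : Prog) : Prog
  /-- run `f` if the result of `c` is not the number `0`, and `g` if it is -/
  | ite (c f g : Prog) : Prog
  /-- repeat `b` as long as the result of `c` is not the number `0` -/
  | loop (c b : Prog) : Prog

/-- `Prog.Eval P v w t`: on input `v` the program `P` halts with output `w` after time `t`. -/
inductive Prog.Eval : Prog → Val → Val → ℕ → Prop
  | prim (o : Prim) (v : Val) :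
      Prog.Eval (.prim o) v (o.apply v) (v.size + (o.apply v).size + 1)
  | comp {f g : Prog} {v w x : Val} {t₁ t₂ : ℕ} :
      Prog.Eval f v w t₁ → Prog.Eval g w x t₂ → Prog.Eval (.comp g f) v x (t₁ + t₂ + 1)
  | pair {f g : Prog} {v a b : Val} {t₁ t₂ : ℕ} :
      Prog.Eval f v a t₁ → Prog.Eval g v b t₂ →
      Prog.Eval (.pair f g) v (.pair a b) (t₁ + t₂ + v.size + 1)
  | ite_true {c f g : Prog} {v w x : Val} {t₁ t₂ : ℕ} :
      Prog.Eval c v w t₁ → w ≠ .num 0 → Prog.Eval f v x t₂ →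
      Prog.Eval (.ite c f g) v x (t₁ + t₂ + v.size + 1)
  | ite_false {c f g : Prog} {v x : Val} {t₁ t₂ : ℕ} :
      Prog.Eval c v (.num 0) t₁ → Prog.Eval g v x t₂ →
      Prog.Eval (.ite c f g) v x (t₁ + t₂ + v.size + 1)
  | loop_stop {c b : Prog} {v : Val} {t : ℕ} :
      Prog.Eval c v (.num 0) t → Prog.Eval (.loop c b) v v (t + v.size + 1)
  | loop_step {c b : Prog} {v w v' x : Val} {t₁ t₂ t₃ : ℕ} :
      Prog.Eval c v w t₁ → w ≠ .num 0 → Prog.Eval b v v' t₂ →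
      Prog.Eval (.loop c b) v' x t₃ →
      Prog.Eval (.loop c b) v x (t₁ + t₂ + t₃ + v.size + 1)

/-- Lists as data. -/
def Val.ofList : List Val → Val
  | [] => .num 0
  | v :: l => .pair v (Val.ofList l)

/-- Natural numbers as data. -/
def Val.ofNat (a : ℕ) : Val := .num (a : ℤ)

/-- Non-negative rationals as data: numerator and denominator. -/
def Val.ofNNRat (q : NNRat) : Val := .pair (Val.ofNat q.num) (Val.ofNat q.den)

/-! ### Networks, flows, series-parallel graphs -/

/-- A finite undirected multigraph with non-negative costs and capacities on the edges, a source
and a sink.  The order in which `ends` lists the two endpoints of an edge is only a name for its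
two directions. -/
structure Network where
  /-- number of vertices -/
  n : ℕ
  /-- number of edges -/
  m : ℕ
  ends : Fin m → Fin n × Fin n
  cost : Fin m → NNRat
  cap : Fin m → NNRat
  s : Fin n
  t : Fin n
  s_ne_t : s ≠ t

namespace Network

/-- The cost `c(F)` of a set of edges. -/
def setCost (G : Network) (F : Finset (Fin G.m)) : NNRat := ∑ e ∈ F, G.cost e

/-- Flow out of `v` minus flow into `v`.  A direction and a non-negative amount on each edge are
given by one signed number: `f e ≥ 0` means `f e` units from `(ends e).1` to `(ends e).2`, and
`f e ≤ 0` means `-f e` units in the opposite direction. -/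
noncomputable def netOut (G : Network) (f : Fin G.m → ℝ) (v : Fin G.n) : ℝ :=
  (∑ e with (G.ends e).1 = v, f e) - ∑ e with (G.ends e).2 = v, f e

/-- `f` is an `s`-`t` flow in the graph `(V, F)`. -/
structure IsFlow (G : Network) (F : Finset (Fin G.m)) (f : Fin G.m → ℝ) : Prop where
  le_cap : ∀ e ∈ F, |f e| ≤ (G.cap e : ℝ)
  eq_zero : ∀ e ∉ F, f e = 0
  conserve : ∀ v, v ≠ G.s → v ≠ G.t → G.netOut f v = 0

/-- The maximum value of an `s`-`t` flow in the graph `(V, F)`. -/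
noncomputable def maxFlow (G : Network) (F : Finset (Fin G.m)) : ℝ :=
  sSup {x | ∃ f, G.IsFlow F f ∧ G.netOut f G.s = x}

/-- `G.SPOn W F a b`: the subgraph of `G` with vertex set `W` and edge set `F` is series-parallel
with terminals `a` and `b`. -/
inductive SPOn (G : Network) :
    Finset (Fin G.n) → Finset (Fin G.m) → Fin G.n → Fin G.n → Prop
  | edge (e : Fin G.m) (a b : Fin G.n) (hab : a ≠ b)
      (h : G.ends e = (a, b) ∨ G.ends e = (b, a)) : SPOn G {a, b} {e} a b
  | series {W₁ W₂ : Finset (Fin G.n)} {F₁ F₂ : Finset (Fin G.m)} {a c b : Fin G.n}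
      (h₁ : SPOn G W₁ F₁ a c) (h₂ : SPOn G W₂ F₂ c b)
      (hW : W₁ ∩ W₂ = {c}) (hF : Disjoint F₁ F₂) : SPOn G (W₁ ∪ W₂) (F₁ ∪ F₂) a b
  | parallel {W₁ W₂ : Finset (Fin G.n)} {F₁ F₂ : Finset (Fin G.m)} {a b : Fin G.n}
      (h₁ : SPOn G W₁ F₁ a b) (h₂ : SPOn G W₂ F₂ a b)
      (hW : W₁ ∩ W₂ = {a, b}) (hF : Disjoint F₁ F₂) : SPOn G (W₁ ∪ W₂) (F₁ ∪ F₂) a b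

/-- The whole graph is series-parallel; its terminals need not be the source and the sink. -/
def IsSeriesParallel (G : Network) : Prop :=
  ∃ a b, G.SPOn Finset.univ Finset.univ a b

/-- Every capacity lies in `{∑ i, α i * d i : |α i| ≤ K}` for some basis values `d 1, …, d k`
(the coefficients `α i` are integers). -/
def CapsInLattice (G : Network) (k K : ℕ) : Prop :=
  ∃ d : Fin k → ℝ, ∀ e, ∃ α : Fin k → ℤ,
    (∀ i, |α i| ≤ (K : ℤ)) ∧ (G.cap e : ℝ) = ∑ i, (α i : ℝ) * d i

/-- A network as data. -/
def toVal (G : Network) : Val :=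
  Val.ofList [Val.ofNat G.n, Val.ofNat G.s, Val.ofNat G.t,
    Val.ofList (List.ofFn fun e : Fin G.m =>
      Val.ofList [Val.ofNat (G.ends e).1, Val.ofNat (G.ends e).2,
        Val.ofNNRat (G.cost e), Val.ofNNRat (G.cap e)])]

/-- A set of edges, represented by a list of the indices of its elements in some order. -/
def RepresentsEdges (G : Network) (w : Val) (F : Finset (Fin G.m)) : Prop :=
  ∃ l : List (Fin G.m), l.Nodup ∧ l.toFinset = F ∧
    w = Val.ofList (l.map fun e => Val.ofNat e)

end Network

/-! ### The two problems -/

/-- An instance of either problem: a network and a number, which is the budget in BCMFP and the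
demand in CapNDP. -/
structure Instance where
  net : Network
  bound : NNRat

/-- An instance as data. -/
def Instance.toVal (I : Instance) : Val := .pair I.net.toVal (Val.ofNNRat I.bound)

/-- The length of the binary encoding of an instance. -/
def Instance.size (I : Instance) : ℕ := I.toVal.size

/-- `F` is an optimal solution of BCMFP. -/
def IsBCMFPOptimal (I : Instance) (F : Finset (Fin I.net.m)) : Prop :=
  I.net.setCost F ≤ I.bound ∧
    ∀ F', I.net.setCost F' ≤ I.bound → I.net.maxFlow F' ≤ I.net.maxFlow F

/-- `F` meets the demand of CapNDP. -/
def IsCapNDPFeasible (I : Instance) (F : Finset (Fin I.net.m)) : Prop :=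
  (I.bound : ℝ) ≤ I.net.maxFlow F

/-- `F` is an optimal solution of CapNDP. -/
def IsCapNDPOptimal (I : Instance) (F : Finset (Fin I.net.m)) : Prop :=
  IsCapNDPFeasible I F ∧ ∀ F', IsCapNDPFeasible I F' → I.net.setCost F ≤ I.net.setCost F'

/-- `w` is a correct answer for the BCMFP instance: an optimal set of edges. -/
def BCMFPAnswer (I : Instance) (w : Val) : Prop :=
  ∃ F, I.net.RepresentsEdges w F ∧ IsBCMFPOptimal I F

/-- `w` is a correct answer for the CapNDP instance: an optimal set of edges (tagged by `1`), or
the number `0` if no set of edges meets the demand. -/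
def CapNDPAnswer (I : Instance) (w : Val) : Prop :=
  (∃ w' F, w = .pair (.num 1) w' ∧ I.net.RepresentsEdges w' F ∧ IsCapNDPOptimal I F) ∨
    (w = .num 0 ∧ ∀ F, ¬ IsCapNDPFeasible I F)

/-- One program gives a correct answer on every instance of the class, in time bounded by a
polynomial in the size of the instance. -/
def PolyTimeSolvable (C : Set Instance) (Answer : Instance → Val → Prop) : Prop :=
  ∃ (P : Prog) (q : Polynomial ℕ), ∀ I ∈ C, ∃ (w : Val) (t : ℕ),
    P.Eval I.toVal w t ∧ t ≤ q.eval I.size ∧ Answer I w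

/-- Series-parallel instances whose capacities lie in a lattice with `k` basis values and with
coefficients bounded by `p` (size of the instance). -/
def latticeInstances (k : ℕ) (p : Polynomial ℕ) : Set Instance :=
  {I | I.net.IsSeriesParallel ∧ ∃ K : ℕ, K ≤ p.eval I.size ∧ I.net.CapsInLattice k K}

/-!
The algorithm is a dynamic program over series and parallel compositions.  By max-flow min-cut, the
maximum flow in a set `F` of edges is the minimum capacity of a cut
(`Network.exists_maxFlow_eq_cutCap`).  A subgraph with two terminals, together with a set `F` of its
edges, therefore only matters through the four minimum capacities of cuts of the subgraph within
`F`, one for each way to place the terminals on the two sides.  A source or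
sink that is not a terminal of the subgraph has its fixed side here, and one that is a terminal gets
it when the terminal is eliminated; so the source and the sink may lie anywhere.  Under a parallel
composition these capacities add up; under a series composition one minimizes over the sides
allowed for the common terminal.  For each subgraph the program keeps a table with one cheapest set
`F` for each quadruple of capacities, and both problems are solved by inspecting the table of the
whole graph (`Instance.exists_edges_of_mem`, `Instance.exists_mem_of_edges`).

Every entry of a quadruple is the sum of the capacities of some edges
(`SuperEdge.Valid.sum`).  If all capacities are combinations of `d 1, …, d k` with integer
coefficients of absolute value at most `K`, then there are at most `(2 m K + 1) ^ k` such sums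
(`card_subset_sums_le`), so a table has at most `(2 m K + 1) ^ (4 k)` rows, a polynomial number.  The
program does not need to know `K` or the numbers `d i`.

The program does not know a decomposition of the graph either.  It keeps a list of subgraphs, at
first the single edges, and composes two of them as long as it finds a parallel pair or a vertex that
belongs to exactly two of them.  Such a composition is always correct for the minimum capacities of
cuts.  That the list shrinks to one member rests on three facts about series-parallel multigraphs:
one with at least two edges has parallel edges or a vertex of degree two with distinct neighbours
(`SP.exists_reduction`), and both deleting one of two parallel edges (`SP.erase_of_two_le_count`) and
replacing a vertex of degree two, terminal or not, by an edge (`SP.exists_elim`) lead to a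
series-parallel multigraph again.

Programs are not written down.  `PolyFun f` says that some program computes `f` on encoded data in
polynomial time; this class of functions is closed under composition, branching and folds over lists
with intermediate results of polynomial size (`PolyFun.foldl_of_bound`), and the algorithm is a
composition of such functions.  For the main loop the bound on intermediate results holds on the
instances in question only, so there `PolyFun` is used with a subtype of instances as the domain.
-/

/-! ### Polynomial-time functions between encoded types -/

/-- Writing the output takes time, so the output is no larger than the running time. -/
theorem Prog.Eval.size_le {P : Prog} {v w : Val} {t : ℕ} (h : P.Eval v w t) : w.size ≤ t := by
  induction h <;> (try simp only [Val.size] at *) <;> omega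

theorem Polynomial.eval_nat_mono (q : Polynomial ℕ) {a b : ℕ} (h : a ≤ b) :
    q.eval a ≤ q.eval b := by
  rw [Polynomial.eval_eq_sum_range, Polynomial.eval_eq_sum_range]
  gcongr

/-- A type whose elements are presented to the machine as data.  The encoding need not be
injective: components that are only used in proofs may be left out. -/
class Enc (α : Type) where
  /-- the datum that presents an element -/
  enc : α → Val

open Enc

/-- Bit size of the datum that presents `x`. -/
def esize {α : Type} [Enc α] (x : α) : ℕ := (enc x).size

instance : Enc ℤ := ⟨Val.num⟩
instance : Enc ℕ := ⟨Val.ofNat⟩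
instance : Enc Unit := ⟨fun _ => .num 0⟩
instance : Enc Bool := ⟨fun b => .num (if b then 1 else 0)⟩
instance {α β : Type} [Enc α] [Enc β] : Enc (α × β) := ⟨fun p => .pair (enc p.1) (enc p.2)⟩
instance {α : Type} [Enc α] : Enc (List α) := ⟨fun l => Val.ofList (l.map enc)⟩

/-- `none` is the number `0`, and `some x` is `x` tagged by `1`. -/
instance {α : Type} [Enc α] : Enc (Option α) :=
  ⟨fun o => o.elim (.num 0) fun x => .pair (.num 1) (enc x)⟩

section
variable {α β γ δ : Type} [Enc α] [Enc β] [Enc γ] [Enc δ]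

/-- `b x` is at most a polynomial in the size of `x`. -/
def PolyBdd (b : α → ℕ) : Prop := ∃ q : Polynomial ℕ, ∀ x, b x ≤ q.eval (esize x)

/-- `f` is computed by a program in polynomial time. -/
@[fun_prop]
def PolyFun (f : α → β) : Prop :=
  ∃ (P : Prog) (b : α → ℕ), PolyBdd b ∧ ∀ x, ∃ t, P.Eval (enc x) (enc (f x)) t ∧ t ≤ b x

namespace PolyBdd

theorem mono {b c : α → ℕ} (hc : PolyBdd c) (h : ∀ x, b x ≤ c x) : PolyBdd b :=
  let ⟨q, hq⟩ := hc
  ⟨q, fun x => (h x).trans (hq x)⟩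

theorem const (n : ℕ) : PolyBdd fun _ : α => n := ⟨Polynomial.C n, fun x => by simp⟩

theorem esize : PolyBdd fun x : α => esize x := ⟨Polynomial.X, fun x => by simp⟩

theorem add {b c : α → ℕ} (hb : PolyBdd b) (hc : PolyBdd c) : PolyBdd fun x => b x + c x :=
  let ⟨q, hq⟩ := hb
  let ⟨r, hr⟩ := hc
  ⟨q + r, fun x => by simpa using add_le_add (hq x) (hr x)⟩

theorem mul {b c : α → ℕ} (hb : PolyBdd b) (hc : PolyBdd c) : PolyBdd fun x => b x * c x :=
  let ⟨q, hq⟩ := hb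
  let ⟨r, hr⟩ := hc
  ⟨q * r, fun x => by simpa using Nat.mul_le_mul (hq x) (hr x)⟩

theorem pow {b : α → ℕ} (hb : PolyBdd b) (n : ℕ) : PolyBdd fun x => b x ^ n :=
  let ⟨q, hq⟩ := hb
  ⟨q ^ n, fun x => by simpa using Nat.pow_le_pow_left (hq x) n⟩

theorem eval {b : α → ℕ} (hb : PolyBdd b) (p : Polynomial ℕ) : PolyBdd fun x => p.eval (b x) :=
  let ⟨q, hq⟩ := hb
  ⟨p.comp q, fun x => by simpa [Polynomial.eval_comp] using p.eval_nat_mono (hq x)⟩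

theorem esize_comp {f : α → β} (hf : PolyFun f) : PolyBdd fun x => _root_.esize (f x) := by
  obtain ⟨P, b, hb, h⟩ := hf
  refine hb.mono fun x => ?_
  obtain ⟨t, ht, htb⟩ := h x
  exact ht.size_le.trans htb

theorem comp {f : α → β} {b : β → ℕ} (hb : PolyBdd b) (hf : PolyFun f) :
    PolyBdd fun x => b (f x) := by
  obtain ⟨q, hq⟩ := hb
  exact ((esize_comp hf).eval q).mono fun x => hq _

end PolyBdd

namespace PolyFun

theorem of_enc_eq {f : α → β} (h : ∀ x, enc (f x) = enc x) : PolyFun f :=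
  ⟨.prim .id, fun x => esize x + esize x + 1,
    (PolyBdd.esize.add PolyBdd.esize).add (PolyBdd.const 1), fun x =>
    ⟨_, by rw [h x]; exact Prog.Eval.prim .id (enc x), le_rfl⟩⟩

/-- Two functions with the same values as data are computed by the same programs. -/
theorem congr_enc {f : α → β} {g : α → γ} (hf : PolyFun f) (h : ∀ x, enc (f x) = enc (g x)) :
    PolyFun g := by
  obtain ⟨P, b, hb, hP⟩ := hf
  exact ⟨P, b, hb, fun x => by simpa only [h] using hP x⟩

/-- An elementary operation is a polynomial-time function as soon as its result has polynomial
size. -/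
theorem of_prim {f : α → β} (o : Prim) (h : ∀ x, o.apply (enc x) = enc (f x))
    (hs : PolyBdd fun x => esize (f x)) : PolyFun f :=
  ⟨.prim o, fun x => esize x + esize (f x) + 1,
    (PolyBdd.esize.add hs).add (PolyBdd.const 1), fun x =>
    ⟨_, by rw [← h x]; exact Prog.Eval.prim o (enc x), by simp [esize, h x]⟩⟩

@[fun_prop]
theorem id : PolyFun fun x : α => x := of_enc_eq fun _ => rfl

@[fun_prop]
theorem comp {g : β → γ} {f : α → β} (hg : PolyFun g) (hf : PolyFun f) :
    PolyFun fun x => g (f x) := by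
  obtain ⟨Q, c, hc, hQ⟩ := hg
  obtain ⟨P, b, hb, hP⟩ := hf
  refine ⟨.comp Q P, fun x => b x + c (f x) + 1,
    (hb.add (hc.comp ⟨P, b, hb, hP⟩)).add (PolyBdd.const 1), fun x => ?_⟩
  obtain ⟨t, ht, htb⟩ := hP x
  obtain ⟨u, hu, huc⟩ := hQ (f x)
  exact ⟨_, .comp ht hu, by dsimp only; omega⟩

@[fun_prop]
theorem prodMk {f : α → β} {g : α → γ} (hf : PolyFun f) (hg : PolyFun g) :
    PolyFun fun x => (f x, g x) := by
  obtain ⟨P, b, hb, hP⟩ := hf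
  obtain ⟨Q, c, hc, hQ⟩ := hg
  refine ⟨.pair P Q, fun x => b x + c x + esize x + 1,
    ((hb.add hc).add PolyBdd.esize).add (PolyBdd.const 1), fun x => ?_⟩
  obtain ⟨t, ht, htb⟩ := hP x
  obtain ⟨u, hu, huc⟩ := hQ x
  exact ⟨_, .pair ht hu, by simp only [esize]; omega⟩

@[fun_prop]
theorem fst {f : α → β × γ} (hf : PolyFun f) : PolyFun fun x => (f x).1 :=
  comp (g := Prod.fst) (of_prim .fst (fun _ => rfl) (PolyBdd.esize.mono fun x => by
    simp only [esize, enc, Val.size]; omega)) hf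

@[fun_prop]
theorem snd {f : α → β × γ} (hf : PolyFun f) : PolyFun fun x => (f x).2 :=
  comp (g := Prod.snd) (of_prim .snd (fun _ => rfl) (PolyBdd.esize.mono fun x => by
    simp only [esize, enc, Val.size]; omega)) hf

theorem exists_const_prog (w : Val) : ∃ (P : Prog) (c : ℕ), ∀ v : Val, ∃ t,
    P.Eval v w t ∧ t ≤ c * (v.size + 1) := by
  induction w with
  | num z =>
    refine ⟨.prim (.const z), (Val.num z).size + 1, fun v => ⟨_, .prim _ v, ?_⟩⟩
    simp only [Prim.apply]
    nlinarith
  | pair a b iha ihb =>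
    obtain ⟨P, c, hP⟩ := iha
    obtain ⟨Q, d, hQ⟩ := ihb
    refine ⟨.pair P Q, c + d + 1, fun v => ?_⟩
    obtain ⟨t, ht, htb⟩ := hP v
    obtain ⟨u, hu, huc⟩ := hQ v
    exact ⟨_, .pair ht hu, by nlinarith⟩

@[fun_prop]
theorem const (y : β) : PolyFun fun _ : α => y := by
  obtain ⟨P, c, hP⟩ := exists_const_prog (enc y)
  exact ⟨P, fun x => c * (esize x + 1),
    (PolyBdd.const c).mul (PolyBdd.esize.add (PolyBdd.const 1)), fun x => hP (enc x)⟩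

@[fun_prop]
theorem natCast {f : α → ℕ} (hf : PolyFun f) : PolyFun fun x => (f x : ℤ) :=
  hf.congr_enc fun _ => rfl

end PolyFun

theorem Int.size_natAbs_add_le (x y : ℤ) :
    (x + y).natAbs.size ≤ x.natAbs.size + y.natAbs.size + 1 := by
  rw [Nat.size_le]
  have hx := Nat.lt_size_self x.natAbs
  have hy := Nat.lt_size_self y.natAbs
  have h1 : 2 ^ x.natAbs.size ≤ 2 ^ (x.natAbs.size + y.natAbs.size) :=
    Nat.pow_le_pow_right (by norm_num) (by omega)
  have h2 : 2 ^ y.natAbs.size ≤ 2 ^ (x.natAbs.size + y.natAbs.size) :=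
    Nat.pow_le_pow_right (by norm_num) (by omega)
  rw [pow_succ]
  have := Int.natAbs_add_le x y
  omega

theorem Int.size_natAbs_mul_le (x y : ℤ) :
    (x * y).natAbs.size ≤ x.natAbs.size + y.natAbs.size := by
  rw [Nat.size_le, Int.natAbs_mul, pow_add]
  exact Nat.mul_lt_mul'' (Nat.lt_size_self _) (Nat.lt_size_self _)

namespace PolyFun

@[fun_prop]
theorem int_add {f g : α → ℤ} (hf : PolyFun f) (hg : PolyFun g) : PolyFun fun x => f x + g x :=
  comp (g := fun p : ℤ × ℤ => p.1 + p.2) (of_prim .add (fun _ => rfl)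
    (PolyBdd.esize.mono fun p => by
      have := Int.size_natAbs_add_le p.1 p.2
      simp only [esize, enc, Val.size]; omega)) (hf.prodMk hg)

@[fun_prop]
theorem int_mul {f g : α → ℤ} (hf : PolyFun f) (hg : PolyFun g) : PolyFun fun x => f x * g x :=
  comp (g := fun p : ℤ × ℤ => p.1 * p.2) (of_prim .mul (fun _ => rfl)
    (PolyBdd.esize.mono fun p => by
      have := Int.size_natAbs_mul_le p.1 p.2
      simp only [esize, enc, Val.size]; omega)) (hf.prodMk hg)

@[fun_prop]
theorem int_le {f g : α → ℤ} (hf : PolyFun f) (hg : PolyFun g) :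
    PolyFun fun x => decide (f x ≤ g x) :=
  comp (g := fun p : ℤ × ℤ => decide (p.1 ≤ p.2)) (of_prim .le (fun p => by
      simp only [enc, Prim.apply, decide_eq_true_eq])
    (PolyBdd.esize.mono fun p => by
      have h : ∀ b : Bool, (if b then (1 : ℤ) else 0).natAbs.size ≤ 1 := by decide
      have := h (decide (p.1 ≤ p.2))
      simp only [esize, enc, Val.size]; omega)) (hf.prodMk hg)

@[fun_prop]
theorem cond {c : α → Bool} {f g : α → β} (hc : PolyFun c) (hf : PolyFun f) (hg : PolyFun g) :
    PolyFun fun x => bif c x then f x else g x := by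
  obtain ⟨C, b₀, hb₀, hC⟩ := hc
  obtain ⟨P, b₁, hb₁, hP⟩ := hf
  obtain ⟨Q, b₂, hb₂, hQ⟩ := hg
  refine ⟨.ite C P Q, fun x => b₀ x + b₁ x + b₂ x + esize x + 1,
    (((hb₀.add hb₁).add hb₂).add PolyBdd.esize).add (PolyBdd.const 1), fun x => ?_⟩
  obtain ⟨t, ht, htb⟩ := hC x
  cases h : c x with
  | true =>
    obtain ⟨u, hu, huc⟩ := hP x
    rw [h] at ht
    refine ⟨_, by dsimp only; rw [h]; exact .ite_true ht (by simp [enc]) hu, ?_⟩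
    simp only [esize]; omega
  | false =>
    obtain ⟨u, hu, huc⟩ := hQ x
    rw [h] at ht
    refine ⟨_, by dsimp only; rw [h]; exact .ite_false ht hu, ?_⟩
    simp only [esize]; omega

@[fun_prop]
theorem and {f g : α → Bool} (hf : PolyFun f) (hg : PolyFun g) : PolyFun fun x => f x && g x := by
  have := cond hf hg (const false)
  exact this.congr_enc fun x => by cases f x <;> rfl

@[fun_prop]
theorem not {f : α → Bool} (hf : PolyFun f) : PolyFun fun x => !f x := by
  have := cond hf (const false) (const true)
  exact this.congr_enc fun x => by cases f x <;> rfl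

@[fun_prop]
theorem int_eq {f g : α → ℤ} (hf : PolyFun f) (hg : PolyFun g) :
    PolyFun fun x => decide (f x = g x) :=
  ((int_le hf hg).and (int_le hg hf)).congr_enc fun x => by
    rw [← Bool.decide_and]; simp only [le_antisymm_iff]

@[fun_prop]
theorem nat_eq {f g : α → ℕ} (hf : PolyFun f) (hg : PolyFun g) :
    PolyFun fun x => decide (f x = g x) :=
  (int_eq hf.natCast hg.natCast).congr_enc fun x => by simp only [Int.natCast_inj]

@[fun_prop]
theorem int_min {f g : α → ℤ} (hf : PolyFun f) (hg : PolyFun g) :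
    PolyFun fun x => min (f x) (g x) :=
  (cond (int_le hf hg) hf hg).congr_enc fun x => by rw [Bool.cond_decide, min_def]

end PolyFun

end

/-! ### Loops over lists -/

/-- The running time of a loop with `n` rounds and the states `σ 0, …, σ n`, when `T` bounds the
time of each condition, the time of each round and the size of each state. -/
theorem Prog.Eval.loop_of_bound {c b : Prog} {T : ℕ} (n : ℕ) (σ : ℕ → Val)
    (hc : ∀ i < n, ∃ w t, c.Eval (σ i) w t ∧ w ≠ .num 0 ∧ t ≤ T)
    (hb : ∀ i < n, ∃ t, b.Eval (σ i) (σ (i + 1)) t ∧ t ≤ T)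
    (hn : ∃ t, c.Eval (σ n) (.num 0) t ∧ t ≤ T) (hs : ∀ i ≤ n, (σ i).size ≤ T) :
    ∃ t, (Prog.loop c b).Eval (σ 0) (σ n) t ∧ t ≤ (n + 1) * (3 * T + 1) := by
  induction n generalizing σ with
  | zero =>
    obtain ⟨t, ht, htT⟩ := hn
    have := hs 0 le_rfl
    refine ⟨t + (σ 0).size + 1, ?_, by omega⟩
    constructor
    exact ht
  | succ n ih =>
    obtain ⟨t, ht, htT⟩ := ih (fun i => σ (i + 1)) (fun i hi => hc _ (by omega))
      (fun i hi => hb _ (by omega)) hn (fun i hi => hs _ (by omega))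
    obtain ⟨w, u, hu, hw, huT⟩ := hc 0 (by omega)
    obtain ⟨r, hr, hrT⟩ := hb 0 (by omega)
    have := hs 0 (by omega)
    exact ⟨_, .loop_step hu hw hr ht, by nlinarith⟩

section
variable {α β γ δ : Type} [Enc α] [Enc β] [Enc γ] [Enc δ]

theorem esize_nil : esize ([] : List α) = 1 := by
  simp [esize, enc, Val.ofList, Val.size]

theorem esize_cons (a : α) (l : List α) : esize (a :: l) = esize a + esize l + 1 := rfl

theorem esize_pair (a : α) (b : β) : esize (a, b) = esize a + esize b + 1 := rfl

theorem esize_append (l l' : List α) : esize (l ++ l') + 1 = esize l + esize l' := by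
  induction l with
  | nil => simp [esize_nil]; omega
  | cons a l ih => simp only [List.cons_append, esize_cons]; omega

theorem esize_eq_sum (l : List α) : esize l = (l.map fun a => esize a + 1).sum + 1 := by
  induction l with
  | nil => simp [esize_nil]
  | cons a l ih => simp only [List.map_cons, List.sum_cons, esize_cons]; omega

theorem esize_sublist {l l' : List α} (h : l.Sublist l') : esize l ≤ esize l' := by
  induction h with
  | slnil => rfl
  | cons a _ ih => rw [esize_cons]; omega
  | cons_cons a _ ih => rw [esize_cons, esize_cons]; omega

theorem length_lt_esize (l : List α) : l.length < esize l := by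
  induction l with
  | nil => simp [esize_nil]
  | cons a l ih => simp only [List.length_cons, esize_cons]; omega

theorem esize_le_of_mem {l : List α} {a : α} (h : a ∈ l) : esize a + 2 ≤ esize l := by
  have := esize_sublist (List.singleton_sublist.2 h)
  rw [esize_cons, esize_nil] at this
  omega

theorem esize_list_le {l : List α} {n b : ℕ} (hn : l.length ≤ n) (hb : ∀ a ∈ l, esize a ≤ b) :
    esize l ≤ n * (b + 1) + 1 := by
  rw [esize_eq_sum]
  have := List.sum_le_card_nsmul (l.map fun a => esize a + 1) (b + 1) (by
    simp only [List.mem_map]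
    rintro _ ⟨a, ha, rfl⟩
    exact Nat.succ_le_succ (hb a ha))
  simp only [List.length_map, smul_eq_mul] at this
  have := Nat.mul_le_mul_right (b + 1) hn
  omega

namespace PolyFun

theorem list_isCons {l : α → List β} (hl : PolyFun l) : PolyFun fun x => !(l x).isEmpty :=
  comp (g := fun l : List β => !l.isEmpty) (of_prim .isPair (fun l => by cases l <;> rfl)
    ((PolyBdd.const 2).mono fun l => by
      cases l <;> simp [esize, enc, Val.size])) hl

@[fun_prop]
theorem list_isEmpty {l : α → List β} (hl : PolyFun l) : PolyFun fun x => (l x).isEmpty :=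
  (list_isCons hl).not.congr_enc fun x => by rw [Bool.not_not]

/-- A fold over a list runs in polynomial time if its step does and all intermediate results have
polynomial size. -/
theorem foldl_of_bound {l : α → List γ} {i : α → β} {s : α → β → γ → β} (hl : PolyFun l)
    (hi : PolyFun i) (hs : PolyFun fun p : α × β × γ => s p.1 p.2.1 p.2.2) {B : α → ℕ}
    (hB : PolyBdd B)
    (h : ∀ x l₁ l₂, l x = l₁ ++ l₂ → esize (l₁.foldl (s x) (i x)) ≤ B x) :
    PolyFun fun x => (l x).foldl (s x) (i x) := by
  -- the state of the loop is the context, the rest of the list and the accumulator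
  obtain ⟨Pi, bi, hbi, hPi⟩ : PolyFun fun x => (x, l x, i x) := by fun_prop
  obtain ⟨Pc, bc, ⟨qc, hqc⟩, hPc⟩ : PolyFun fun p : α × List γ × β => !p.2.1.isEmpty :=
    list_isCons (by fun_prop)
  -- a nonempty list and the pair of its head and its tail are the same datum
  obtain ⟨Pb, bb, ⟨qb, hqb⟩, hPb⟩ : PolyFun fun p : α × (γ × List γ) × β =>
      (p.1, p.2.1.2, s p.1 p.2.2 p.2.1.1) := by
    have : PolyFun fun p : α × (γ × List γ) × β => s p.1 p.2.2 p.2.1.1 :=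
      hs.comp (f := fun p : α × (γ × List γ) × β => (p.1, p.2.2, p.2.1.1)) (by fun_prop)
    fun_prop
  have hout : PolyFun fun p : α × List γ × β => p.2.2 := by fun_prop
  let S : α → ℕ := fun x => esize x + esize (l x) + B x + 2
  have hS : PolyBdd S :=
    ((PolyBdd.esize.add (PolyBdd.esize_comp hl)).add hB).add (PolyBdd.const 2)
  let T : α → ℕ := fun x => qc.eval (S x) + qb.eval (S x) + S x
  have hT : PolyBdd T := ((hS.eval qc).add (hS.eval qb)).add hS
  refine hout.comp (f := fun x => (x, ([] : List γ), (l x).foldl (s x) (i x)))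
    ⟨.comp (.loop Pc Pb) Pi, fun x => bi x + (esize (l x) + 1) * (3 * T x + 1) + 1,
      (hbi.add (((PolyBdd.esize_comp hl).add (PolyBdd.const 1)).mul
        (((PolyBdd.const 3).mul hT).add (PolyBdd.const 1)))).add (PolyBdd.const 1), fun x => ?_⟩
  obtain ⟨t, ht, htb⟩ := hPi x
  let τ : ℕ → α × List γ × β := fun j => (x, (l x).drop j, ((l x).take j).foldl (s x) (i x))
  have hτ : ∀ j, esize (τ j) ≤ S x := fun j => by
    have h₁ := h x _ _ (List.take_append_drop j (l x)).symm
    have h₂ := esize_sublist (List.drop_sublist j (l x))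
    simp only [τ, S, esize_pair]
    omega
  have hc : ∀ j, ∃ u, Pc.Eval (enc (τ j)) (enc (!(τ j).2.1.isEmpty)) u ∧ u ≤ T x := fun j => by
    obtain ⟨u, hu, hub⟩ := hPc (τ j)
    have := (hub.trans (hqc _)).trans (qc.eval_nat_mono (hτ j))
    exact ⟨u, hu, by simp only [T]; omega⟩
  obtain ⟨u, hu, hub⟩ := Prog.Eval.loop_of_bound (c := Pc) (b := Pb) (T := T x) (l x).length
    (fun j => enc (τ j))
    (fun j hj => by
      obtain ⟨u, hu, hub⟩ := hc j
      refine ⟨_, u, hu, ?_, hub⟩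
      have : (τ j).2.1 ≠ [] := by simpa [τ] using hj
      simp [enc, this])
    (fun j hj => by
      obtain ⟨u, hu, hub⟩ := hPb (x, ((l x)[j], (l x).drop (j + 1)), (τ j).2.2)
      have hd : (l x).drop j = (l x)[j] :: (l x).drop (j + 1) := List.drop_eq_getElem_cons hj
      have h₁ : enc (τ j) = enc (x, ((l x)[j], (l x).drop (j + 1)), (τ j).2.2) := by
        simp only [τ, hd]; rfl
      have h₂ : τ (j + 1) = (x, (l x).drop (j + 1), s x (τ j).2.2 (l x)[j]) := by
        simp only [τ, List.take_add_one, List.getElem?_eq_getElem hj, Option.toList_some,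
          List.foldl_append, List.foldl_cons, List.foldl_nil]
      refine ⟨u, by rw [h₁, h₂]; exact hu, ?_⟩
      have := (hub.trans (hqb _)).trans (qb.eval_nat_mono (show _ ≤ S x by
        have := hτ j; unfold esize at this ⊢; rwa [h₁] at this))
      simp only [T]; omega)
    (by simpa [τ, enc] using hc (l x).length)
    (fun j _ => by have := hτ j; simp only [T]; unfold esize at this; omega)
  have h0 : τ 0 = (x, l x, i x) := by simp [τ]
  have hlast : τ (l x).length = (x, [], (l x).foldl (s x) (i x)) := by simp [τ]
  rw [h0, hlast] at hu
  refine ⟨_, .comp ht hu, ?_⟩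
  have h₁ := length_lt_esize (l x)
  have := Nat.mul_le_mul_right (3 * T x + 1) (show (l x).length + 1 ≤ esize (l x) + 1 by omega)
  dsimp only
  omega

/-- A fold over a list runs in polynomial time if each step adds at most a polynomial amount to
the accumulator, independently of the accumulator. -/
theorem foldl_of_growth {l : α → List γ} {i : α → β} {s : α → β → γ → β} (hl : PolyFun l)
    (hi : PolyFun i) (hs : PolyFun fun p : α × β × γ => s p.1 p.2.1 p.2.2) {B : α × γ → ℕ}
    (hB : PolyBdd B) (h : ∀ x b c, esize (s x b c) ≤ esize b + B (x, c)) :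
    PolyFun fun x => (l x).foldl (s x) (i x) := by
  obtain ⟨q, hq⟩ := hB
  refine foldl_of_bound hl hi hs
    (B := fun x => esize (i x) + esize (l x) * q.eval (esize x + esize (l x) + 1))
    ((PolyBdd.esize_comp hi).add ((PolyBdd.esize_comp hl).mul
      (PolyBdd.eval ((PolyBdd.esize.add (PolyBdd.esize_comp hl)).add (PolyBdd.const 1)) q)))
    fun x l₁ l₂ hl₁₂ => ?_
  have key : ∀ (l' : List γ) (b : β), (∀ c ∈ l', c ∈ l x) → esize (l'.foldl (s x) b) ≤
      esize b + l'.length * q.eval (esize x + esize (l x) + 1) := by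
    intro l'
    induction l' with
    | nil => simp
    | cons c l' ih =>
      intro b hmem
      have h₁ := ih (s x b c) fun c hc => hmem c (by simp [hc])
      have h₂ := h x b c
      have h₃ := esize_le_of_mem (hmem c (by simp))
      have h₄ := (hq (x, c)).trans (q.eval_nat_mono
        (show esize (x, c) ≤ esize x + esize (l x) + 1 by rw [esize_pair]; omega))
      rw [List.length_cons, Nat.succ_mul, List.foldl_cons]
      omega
  refine (key l₁ _ (by simp +contextual [hl₁₂])).trans ?_
  have h₁ := length_lt_esize (l x)
  have h₂ : l₁.length ≤ (l x).length := by simp [hl₁₂]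
  have := Nat.mul_le_mul_right (q.eval (esize x + esize (l x) + 1)) (h₂.trans h₁.le)
  omega

@[fun_prop]
theorem list_cons {f : α → β} {l : α → List β} (hf : PolyFun f) (hl : PolyFun l) :
    PolyFun fun x => f x :: l x :=
  (hf.prodMk hl).congr_enc fun _ => rfl

@[fun_prop]
theorem list_reverse {l : α → List β} (hl : PolyFun l) : PolyFun fun x => (l x).reverse := by
  have : PolyFun fun x => (l x).foldl (fun acc b => b :: acc) [] :=
    foldl_of_growth (s := fun _ acc b => b :: acc) (B := fun p => esize p.2 + 1) hl (const [])
      (by fun_prop) ((PolyBdd.esize_comp (by fun_prop)).add (PolyBdd.const 1))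
      fun x b c => by rw [esize_cons]; dsimp only; omega
  simpa using this

@[fun_prop]
theorem list_append {l l' : α → List β} (hl : PolyFun l) (hl' : PolyFun l') :
    PolyFun fun x => l x ++ l' x := by
  have : PolyFun fun x => (l x).reverse.foldl (fun acc b => b :: acc) (l' x) :=
    foldl_of_growth (s := fun _ acc b => b :: acc) (B := fun p => esize p.2 + 1)
      hl.list_reverse hl'
      (by fun_prop) ((PolyBdd.esize_comp (by fun_prop)).add (PolyBdd.const 1))
      fun x b c => by rw [esize_cons]; dsimp only; omega
  simpa using this

@[fun_prop]
theorem list_flatMap {l : α → List β} {f : α → β → List γ} (hl : PolyFun l)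
    (hf : PolyFun fun p : α × β => f p.1 p.2) : PolyFun fun x => (l x).flatMap (f x) := by
  have hf' : PolyFun fun p : α × List γ × β => f p.1 p.2.2 :=
    hf.comp (f := fun p : α × List γ × β => (p.1, p.2.2)) (by fun_prop)
  have : PolyFun fun x => (l x).foldl (fun acc b => acc ++ f x b) [] :=
    foldl_of_growth (s := fun x acc b => acc ++ f x b) (B := fun p => esize (f p.1 p.2)) hl
      (const []) (by fun_prop) (PolyBdd.esize_comp hf)
      fun x b c => by have := esize_append b (f x c); dsimp only; omega
  refine this.congr_enc fun x => ?_
  rw [← List.flatMap_eq_foldl]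

@[fun_prop]
theorem list_map {l : α → List β} {f : α → β → γ} (hl : PolyFun l)
    (hf : PolyFun fun p : α × β => f p.1 p.2) : PolyFun fun x => (l x).map (f x) := by
  have : PolyFun fun x => (l x).flatMap fun b => [f x b] :=
    list_flatMap hl (list_cons hf (const []))
  exact this.congr_enc fun x => by rw [List.map_eq_flatMap]

@[fun_prop]
theorem list_filter {l : α → List β} {f : α → β → Bool} (hl : PolyFun l)
    (hf : PolyFun fun p : α × β => f p.1 p.2) : PolyFun fun x => (l x).filter (f x) := by
  have : PolyFun fun x => (l x).flatMap fun b => bif f x b then [b] else [] :=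
    list_flatMap hl (cond hf (by fun_prop) (const []))
  refine this.congr_enc fun x => congrArg enc ?_
  induction l x with
  | nil => rfl
  | cons b l ih => cases h : f x b <;> simp [h, ih]

@[fun_prop]
theorem list_any {l : α → List β} {f : α → β → Bool} (hl : PolyFun l)
    (hf : PolyFun fun p : α × β => f p.1 p.2) : PolyFun fun x => (l x).any (f x) := by
  refine (list_isEmpty (list_filter hl hf)).not.congr_enc fun x => congrArg enc ?_
  induction l x with
  | nil => rfl
  | cons b l ih => cases h : f x b <;> simp [h, ih]

@[fun_prop]
theorem list_all {l : α → List β} {f : α → β → Bool} (hl : PolyFun l)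
    (hf : PolyFun fun p : α × β => f p.1 p.2) : PolyFun fun x => (l x).all (f x) := by
  refine (list_any (f := fun x b => !f x b) hl hf.not).not.congr_enc fun x => ?_
  rw [List.not_any_eq_all_not]; simp

@[fun_prop]
theorem list_headD {l : α → List β} {f : α → β} (hl : PolyFun l) (hf : PolyFun f) :
    PolyFun fun x => (l x).headD (f x) := by
  have : PolyFun fun x => (l x).reverse.foldl (fun _ b => b) (f x) := by
    refine foldl_of_growth (s := fun _ _ b => b) (B := fun p => esize p.2) hl.list_reverse hf
      (by fun_prop) (PolyBdd.esize_comp (by fun_prop)) fun x b c => by dsimp only; omega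
  refine this.congr_enc fun x => ?_
  rw [List.foldl_reverse]
  cases l x <;> rfl

end PolyFun

/-- All ways to single out an element of a list, with the list of the other elements. -/
def List.picks {α : Type*} : List α → List (α × List α)
  | [] => []
  | a :: l => (a, l) :: l.picks.map fun p => (p.1, a :: p.2)

@[simp]
theorem List.length_picks {α : Type*} (l : List α) : l.picks.length = l.length := by
  induction l with
  | nil => rfl
  | cons a l ih => simp [List.picks, ih]

theorem Int.esize_add_le (x y : ℤ) : esize (x + y) ≤ esize x + esize y := by
  have := Int.size_natAbs_add_le x y
  simp only [esize, enc, Val.size]; omega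

theorem Int.esize_mul_le (x y : ℤ) : esize (x * y) ≤ esize x + esize y := by
  have := Int.size_natAbs_mul_le x y
  simp only [esize, enc, Val.size]; omega

namespace PolyFun

@[fun_prop]
theorem list_prod {l : α → List ℤ} (hl : PolyFun l) : PolyFun fun x => (l x).prod := by
  have : PolyFun fun x => (l x).foldl (fun a b => a * b) 1 :=
    foldl_of_growth (s := fun _ a b => a * b) (B := fun p => esize p.2) hl (const 1)
      (by fun_prop) (PolyBdd.esize_comp (by fun_prop)) fun x b c => Int.esize_mul_le b c
  simpa [List.prod_eq_foldl] using this

@[fun_prop]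
theorem list_length {l : α → List β} (hl : PolyFun l) : PolyFun fun x => (l x).length := by
  have : PolyFun fun x => (l x).foldl (fun (a : ℤ) _ => a + 1) 0 :=
    foldl_of_growth (s := fun _ (a : ℤ) _ => a + 1) (B := fun p => esize (1 : ℤ)) hl (const 0)
      (by fun_prop) (PolyBdd.const _) fun x b c => Int.esize_add_le b 1
  refine this.congr_enc fun x => ?_
  suffices ∀ (l : List β) (a : ℤ), l.foldl (fun (a : ℤ) _ => a + 1) a = a + l.length by
    rw [this, zero_add]; rfl
  intro l
  induction l with
  | nil => simp
  | cons b l ih => intro a; simp [ih]; ring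

@[fun_prop]
theorem list_zipIdx {l : α → List β} (hl : PolyFun l) : PolyFun fun x => (l x).zipIdx := by
  have key (l : List β) : l.foldl (fun acc b => acc ++ [(b, acc.length)]) [] = l.zipIdx := by
    induction l using List.reverseRecOn with
    | nil => rfl
    | append_singleton l b ih => simp [ih, List.zipIdx_append]
  have : PolyFun fun x => (l x).foldl (fun acc b => acc ++ [(b, acc.length)]) [] := by
    refine foldl_of_bound (s := fun _ acc b => acc ++ [(b, acc.length)]) hl (const [])
      (by fun_prop) (B := fun x => esize (l x) * (esize (l x) + esize (l x) + 2) + 1)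
      (((PolyBdd.esize_comp hl).mul (((PolyBdd.esize_comp hl).add (PolyBdd.esize_comp hl)).add
        (PolyBdd.const 2))).add (PolyBdd.const 1)) fun x l₁ l₂ h => ?_
    rw [key]
    have h₁ : l₁.length ≤ esize (l x) := by
      have := length_lt_esize (l x)
      simp only [h, List.length_append] at this ⊢
      omega
    refine esize_list_le (b := esize (l x) + esize (l x) + 1) (by simpa using h₁) ?_
    rintro ⟨b, i⟩ hbi
    obtain ⟨h₂, h₃, h₄⟩ := List.mem_zipIdx hbi
    have h₅ : b ∈ l x := by simp [h, h₄]
    have h₆ := esize_le_of_mem h₅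
    have h₇ : esize i ≤ i + 1 := by
      have : i.size ≤ i := Nat.size_le.2 Nat.lt_two_pow_self
      simpa [esize, enc, Val.ofNat, Val.size] using this
    rw [esize_pair]
    omega
  simpa only [key] using this

/-- The list of picks is computed by a fold from the right; its size is at most quadratic. -/
@[fun_prop]
theorem list_picks {l : α → List β} (hl : PolyFun l) : PolyFun fun x => (l x).picks := by
  let s : List β × List (β × List β) → β → List β × List (β × List β) := fun acc b =>
    (b :: acc.1, (b, acc.1) :: acc.2.map fun p => (p.1, b :: p.2))
  have key (l : List β) : l.foldr (fun b acc => s acc b) ([], []) = (l, l.picks) := by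
    induction l with
    | nil => rfl
    | cons b l ih => rw [List.foldr_cons, ih]; rfl
  have hsize (l : List β) : esize l.picks ≤ l.length * (esize l + 1) + 1 := by
    induction l with
    | nil => simp [List.picks, esize_nil]
    | cons b l ih =>
      have : esize (l.picks.map fun p => (p.1, b :: p.2)) ≤
          esize l.picks + l.length * (esize b + 1) := by
        clear ih
        rw [← List.length_picks l]
        induction l.picks with
        | nil => simp
        | cons p L ih =>
          simp only [List.map_cons, esize_cons, esize_pair, List.length_cons, Nat.succ_mul]
          obtain ⟨p, q⟩ := p
          simp only [esize_pair]
          omega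
      rw [List.picks, esize_cons, esize_cons, esize_pair, List.length_cons]
      nlinarith
  have : PolyFun fun x => (l x).reverse.foldl s ([], []) := by
    refine foldl_of_bound (s := fun _ => s) hl.list_reverse (const ([], []))
      (by fun_prop) (B := fun x => esize (l x) * (esize (l x) + 1) + 2 + esize (l x))
      ((((PolyBdd.esize_comp hl).mul ((PolyBdd.esize_comp hl).add (PolyBdd.const 1))).add
        (PolyBdd.const 2)).add (PolyBdd.esize_comp hl)) fun x l₁ l₂ h => ?_
    have h₁ : l x = l₂.reverse ++ l₁.reverse := by
      rw [← List.reverse_append, ← h, List.reverse_reverse]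
    have h₂ : esize l₁.reverse ≤ esize (l x) := esize_sublist (by simp [h₁])
    have h₃ := (length_lt_esize l₁.reverse).le.trans h₂
    rw [← List.foldr_reverse, key, esize_pair]
    have h₄ := hsize l₁.reverse
    have := Nat.mul_le_mul h₃ (Nat.succ_le_succ h₂)
    simp only [Nat.succ_eq_add_one] at this
    omega
  refine (snd this).congr_enc fun x => ?_
  rw [List.foldl_reverse, key]

end PolyFun

theorem List.perm_of_mem_picks {α : Type*} {l r : List α} {a : α} (h : (a, r) ∈ l.picks) :
    l.Perm (a :: r) := by
  induction l generalizing r with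
  | nil => simp [List.picks] at h
  | cons b l ih =>
    rw [List.picks, List.mem_cons, List.mem_map] at h
    obtain h | ⟨⟨c, r'⟩, hp, h⟩ := h
    · cases h; rfl
    · cases h
      exact ((ih hp).cons b).trans (.swap _ _ _)

theorem List.exists_mem_picks {α : Type*} {l : List α} {a : α} (h : a ∈ l) :
    ∃ r, (a, r) ∈ l.picks := by
  induction l with
  | nil => simp at h
  | cons b l ih =>
    obtain rfl | h := List.mem_cons.1 h
    · exact ⟨l, by simp [List.picks]⟩
    · obtain ⟨r, hr⟩ := ih h
      exact ⟨b :: r, by simp only [List.picks, List.mem_cons, List.mem_map]; exact .inr ⟨_, hr, rfl⟩⟩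

end

/-! ### Reductions of series-parallel graphs -/

/-- `SP M a b`: the multigraph with edge multiset `M` is series-parallel with terminals `a`
and `b`.  Its vertices are the endpoints of the edges. -/
inductive SP {V : Type} : Multiset (Sym2 V) → V → V → Prop
  | edge {a b : V} (h : a ≠ b) : SP {s(a, b)} a b
  | series {M N : Multiset (Sym2 V)} {a c b : V} (hM : SP M a c) (hN : SP N c b)
      (h : ∀ v, (∃ e ∈ M, v ∈ e) → (∃ e ∈ N, v ∈ e) → v = c) : SP (M + N) a b
  | parallel {M N : Multiset (Sym2 V)} {a b : V} (hM : SP M a b) (hN : SP N a b)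
      (h : ∀ v, (∃ e ∈ M, v ∈ e) → (∃ e ∈ N, v ∈ e) → v = a ∨ v = b) : SP (M + N) a b

namespace SP

variable {V : Type} {M N : Multiset (Sym2 V)} {a b c x y : V} {e : Sym2 V}

theorem terminals (h : SP M a b) : (∃ e ∈ M, a ∈ e) ∧ (∃ e ∈ M, b ∈ e) ∧ a ≠ b := by
  induction h with
  | edge h => simp [h]
  | @series M N a c b _ _ h ihM ihN =>
    obtain ⟨⟨e, he, hae⟩, _, hac⟩ := ihM
    obtain ⟨_, ⟨f, hf, hbf⟩, _⟩ := ihN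
    refine ⟨⟨e, by simp [he], hae⟩, ⟨f, by simp [hf], hbf⟩, fun hab => hac ?_⟩
    exact h a ⟨e, he, hae⟩ ⟨f, hf, hab ▸ hbf⟩
  | parallel _ _ _ ihM ihN =>
    obtain ⟨⟨e, he, hae⟩, ⟨f, hf, hbf⟩, hab⟩ := ihM
    exact ⟨⟨e, by simp [he], hae⟩, ⟨f, by simp [hf], hbf⟩, hab⟩

theorem ne (h : SP M a b) : a ≠ b := h.terminals.2.2

theorem symm (h : SP M a b) : SP M b a := by
  induction h with
  | edge h => rw [Sym2.eq_swap]; exact .edge h.symm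
  | series _ _ h ihM ihN =>
    rw [add_comm]; exact .series ihN ihM fun v hM hN => h v hN hM
  | parallel _ _ h ihM ihN => exact .parallel ihM ihN fun v hM hN => (h v hM hN).symm

theorem not_isDiag (h : SP M a b) : ∀ e ∈ M, ¬ e.IsDiag := by
  induction h with
  | edge h => simpa using h
  | series _ _ _ ihM ihN | parallel _ _ _ ihM ihN =>
    intro e he
    exact (Multiset.mem_add.1 he).elim (ihM e) (ihN e)

theorem mem_add_iff {v : V} :
    (∃ e ∈ M + N, v ∈ e) ↔ (∃ e ∈ M, v ∈ e) ∨ ∃ e ∈ N, v ∈ e := by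
  simp only [Multiset.mem_add, or_and_right, exists_or]

variable [DecidableEq V]

theorem mem_of_mem_erase {v : V} (h : ∃ f ∈ M.erase e, v ∈ f) : ∃ f ∈ M, v ∈ f :=
  let ⟨f, hf, hv⟩ := h
  ⟨f, Multiset.mem_of_mem_erase hf, hv⟩

/-- An edge that joins the terminals can be deleted. -/
theorem erase_terminals (h : SP M a b) (he : s(a, b) ∈ M) :
    M = {s(a, b)} ∨ SP (M.erase s(a, b)) a b := by
  induction h with
  | edge h => exact .inl rfl
  | @series M N a c b hM hN h ihM ihN =>
    obtain ⟨⟨e, he, hae⟩, _, hac⟩ := hM.terminals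
    obtain ⟨_, ⟨f, hf, hbf⟩, hcb⟩ := hN.terminals
    obtain hm | hm := Multiset.mem_add.1 ‹_›
    · exact absurd (h b ⟨_, hm, by simp⟩ ⟨f, hf, hbf⟩) hcb.symm
    · exact absurd (h a ⟨e, he, hae⟩ ⟨_, hm, by simp⟩) hac
  | @parallel M N a b hM hN h ihM ihN =>
    right
    by_cases hm : s(a, b) ∈ M
    · rw [Multiset.erase_add_left_pos _ hm]
      obtain hM' | hM' := ihM hm
      · simpa [hM'] using hN
      · exact .parallel hM' hN fun v hv hv' => h v (mem_of_mem_erase hv) hv'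
    · have hn := (Multiset.mem_add.1 he).resolve_left hm
      rw [Multiset.erase_add_right_pos _ hn]
      obtain hN' | hN' := ihN hn
      · simpa [hN'] using hM
      · exact .parallel hM hN' fun v hv hv' => h v hv (mem_of_mem_erase hv')

/-- One of two parallel edges can be deleted. -/
theorem erase_of_two_le_count (h : SP M a b) (he : 2 ≤ M.count e) : SP (M.erase e) a b := by
  induction h with
  | edge h =>
    have := he.trans (Multiset.count_le_card e _)
    rw [Multiset.card_singleton] at this
    exact absurd this (by norm_num)
  | @series M N a c b hM hN h ihM ihN =>
    rw [Multiset.count_add] at he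
    by_cases hm : 2 ≤ M.count e
    · rw [Multiset.erase_add_left_pos _ (Multiset.count_pos.1 (by omega))]
      exact .series (ihM hm) hN fun v hv => h v (mem_of_mem_erase hv)
    by_cases hn : 2 ≤ N.count e
    · rw [Multiset.erase_add_right_pos _ (Multiset.count_pos.1 (by omega))]
      exact .series hM (ihN hn) fun v hv hv' => h v hv (mem_of_mem_erase hv')
    -- otherwise both parts contain `e`, but they share only one vertex
    have heM : e ∈ M := Multiset.count_pos.1 (by omega)
    have heN : e ∈ N := Multiset.count_pos.1 (by omega)
    induction e with | _ x y
    refine absurd ?_ (hM.not_isDiag _ heM)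
    rw [Sym2.mk_isDiag_iff, h x ⟨_, heM, by simp⟩ ⟨_, heN, by simp⟩,
      h y ⟨_, heM, by simp⟩ ⟨_, heN, by simp⟩]
  | @parallel M N a b hM hN h ihM ihN =>
    rw [Multiset.count_add] at he
    by_cases hm : 2 ≤ M.count e
    · rw [Multiset.erase_add_left_pos _ (Multiset.count_pos.1 (by omega))]
      exact .parallel (ihM hm) hN fun v hv => h v (mem_of_mem_erase hv)
    by_cases hn : 2 ≤ N.count e
    · rw [Multiset.erase_add_right_pos _ (Multiset.count_pos.1 (by omega))]
      exact .parallel hM (ihN hn) fun v hv hv' => h v hv (mem_of_mem_erase hv')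
    have heM : e ∈ M := Multiset.count_pos.1 (by omega)
    have heN : e ∈ N := Multiset.count_pos.1 (by omega)
    obtain rfl : e = s(a, b) := by
      induction e with | _ x y
      have hd := hM.not_isDiag _ heM
      rw [Sym2.mk_isDiag_iff] at hd
      have hx := h x ⟨_, heM, by simp⟩ ⟨_, heN, by simp⟩
      have hy := h y ⟨_, heM, by simp⟩ ⟨_, heN, by simp⟩
      rw [Sym2.eq_iff]
      grind
    rw [Multiset.erase_add_right_pos _ heN]
    obtain hN' | hN' := hN.erase_terminals heN
    · simpa [hN'] using hM
    · exact .parallel hM hN' fun v hv hv' => h v hv (mem_of_mem_erase hv')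

/-- The edges at the vertex `c`. -/
abbrev star (c : V) (M : Multiset (Sym2 V)) : Multiset (Sym2 V) := M.filter (c ∈ ·)

/-- The edges that avoid the vertex `c`. -/
abbrev costar (c : V) (M : Multiset (Sym2 V)) : Multiset (Sym2 V) := M.filter (c ∉ ·)

theorem star_add : star c (M + N) = star c M + star c N := Multiset.filter_add ..

theorem costar_add : costar c (M + N) = costar c M + costar c N := Multiset.filter_add ..

theorem star_eq_zero (h : ¬ ∃ e ∈ M, c ∈ e) : star c M = 0 :=
  Multiset.filter_eq_nil.2 fun e he hc => h ⟨e, he, hc⟩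

theorem costar_eq_self (h : ¬ ∃ e ∈ M, c ∈ e) : costar c M = M :=
  Multiset.filter_eq_self.2 fun e he hc => h ⟨e, he, hc⟩

theorem card_star_pos (h : ∃ e ∈ M, c ∈ e) : 0 < Multiset.card (star c M) :=
  let ⟨e, he, hc⟩ := h
  Multiset.card_pos_iff_exists_mem.2 ⟨e, Multiset.mem_filter.2 ⟨he, hc⟩⟩

theorem mem_of_mem_costar {v : V} (h : ∃ f ∈ costar c M, v ∈ f) : (∃ f ∈ M, v ∈ f) :=
  let ⟨f, hf, hv⟩ := h
  ⟨f, Multiset.mem_of_mem_filter hf, hv⟩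

theorem not_mem_costar : ¬ ∃ f ∈ costar c M, c ∈ f :=
  fun ⟨_, hf, hc⟩ => (Multiset.mem_filter.1 hf).2 hc

/-- A terminal of degree one can be cut off together with its edge. -/
theorem costar_of_star_eq_singleton (h : SP M c b) (hx : star c M = {s(c, x)}) :
    (x = b ∧ costar c M = 0) ∨ (x ≠ b ∧ SP (costar c M) x b) := by
  induction h with
  | @edge c b h =>
    left
    simp [star, costar, Multiset.filter_singleton] at hx ⊢
    grind
  | @series M N c d b hM hN h ihM ihN =>
    right
    have hcN : ¬ ∃ e ∈ N, c ∈ e := fun hc => hM.ne (h c hM.terminals.1 hc)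
    rw [star_add, star_eq_zero hcN, add_zero] at hx
    rw [costar_add, costar_eq_self hcN]
    obtain ⟨rfl, h0⟩ | ⟨hne, hS⟩ := ihM hx
    · rw [h0, zero_add]; exact ⟨hN.ne, hN⟩
    · have := SP.series hS hN fun v hv => h v (mem_of_mem_costar hv)
      exact ⟨this.ne, this⟩
  | @parallel M N c b hM hN h ihM ihN =>
    have h₁ := card_star_pos hM.terminals.1
    have h₂ := card_star_pos hN.terminals.1
    have := congrArg Multiset.card hx
    rw [star_add, Multiset.card_add, Multiset.card_singleton] at this
    omega

/-- The graph in which a vertex `c` of degree two with the neighbours `x` and `y` is replaced by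
an edge from `x` to `y`. -/
abbrev elim (c x y : V) (M : Multiset (Sym2 V)) : Multiset (Sym2 V) := s(x, y) ::ₘ costar c M

theorem mem_of_star (hx : e ∈ star c M) : e ∈ M := Multiset.mem_of_mem_filter hx

theorem mem_of_mem_elim {v : V} (hs : star c M = {s(c, x), s(c, y)})
    (h : ∃ e ∈ elim c x y M, v ∈ e) : ∃ e ∈ M, v ∈ e := by
  obtain ⟨e, he, hv⟩ := h
  obtain rfl | he := Multiset.mem_cons.1 he
  · obtain rfl | rfl := Sym2.mem_iff.1 hv
    · exact ⟨s(c, v), mem_of_star (by rw [hs]; simp), by simp⟩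
    · exact ⟨s(c, v), mem_of_star (by rw [hs]; simp), by simp⟩
  · exact mem_of_mem_costar ⟨e, he, hv⟩

theorem _root_.Multiset.add_eq_pair {α : Type*} {A B : Multiset α} {p q : α} (h : A + B = {p, q})
    (hA : 0 < Multiset.card A) (hB : 0 < Multiset.card B) :
    (A = {p} ∧ B = {q}) ∨ (A = {q} ∧ B = {p}) := by
  classical
  have hc := congrArg Multiset.card h
  rw [Multiset.card_add, Multiset.card_pair] at hc
  obtain ⟨a, rfl⟩ := Multiset.card_eq_one.1 (show Multiset.card A = 1 by omega)
  obtain ⟨b, rfl⟩ := Multiset.card_eq_one.1 (show Multiset.card B = 1 by omega)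
  have ha : a ∈ ({p, q} : Multiset α) := by rw [← h]; simp
  simp only [Multiset.insert_eq_cons, Multiset.mem_cons, Multiset.mem_singleton] at ha
  rw [Multiset.singleton_add, Multiset.insert_eq_cons] at h
  obtain rfl | rfl := ha
  · exact .inl ⟨rfl, (Multiset.cons_inj_right _).1 h⟩
  · rw [← Multiset.insert_eq_cons a {b}, ← Multiset.insert_eq_cons p, Multiset.pair_comm p,
      Multiset.insert_eq_cons, Multiset.insert_eq_cons] at h
    exact .inr ⟨rfl, (Multiset.cons_inj_right _).1 h⟩

/-- Series composition at a vertex of degree two, after the elimination of this vertex. -/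
theorem series_elim (hM : SP M a c) (hN : SP N c b)
    (h : ∀ v, (∃ e ∈ M, v ∈ e) → (∃ e ∈ N, v ∈ e) → v = c)
    (hx : star c M = {s(c, x)}) (hy : star c N = {s(c, y)}) :
    SP (elim c x y (M + N)) a b := by
  have hxM : ∃ e ∈ M, x ∈ e := ⟨s(c, x), mem_of_star (by rw [hx]; simp), by simp⟩
  have hyN : ∃ e ∈ N, y ∈ e := ⟨s(c, y), mem_of_star (by rw [hy]; simp), by simp⟩
  have hcx : c ≠ x := by
    have := hM.not_isDiag s(c, x) (mem_of_star (by rw [hx]; simp))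
    rwa [Sym2.mk_isDiag_iff] at this
  have hcy : c ≠ y := by
    have := hN.not_isDiag s(c, y) (mem_of_star (by rw [hy]; simp))
    rwa [Sym2.mk_isDiag_iff] at this
  have hxy : x ≠ y := fun hxy => hcx (h x hxM (hxy ▸ hyN)).symm
  have h₁ : SP (costar c M + {s(x, y)}) a y := by
    obtain ⟨rfl, h0⟩ | ⟨_, hS⟩ := hM.symm.costar_of_star_eq_singleton hx
    · rw [h0, zero_add]; exact .edge hxy
    · refine .series hS.symm (.edge hxy) fun v hv hv' => ?_
      simp only [Multiset.mem_singleton, exists_eq_left, Sym2.mem_iff] at hv'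
      obtain rfl | rfl := hv'
      · rfl
      · exact absurd (h v (mem_of_mem_costar hv) hyN) hcy.symm
  rw [elim, costar_add, ← Multiset.singleton_add, ← add_assoc, add_comm {s(x, y)}]
  obtain ⟨rfl, h0⟩ | ⟨_, hS⟩ := hN.costar_of_star_eq_singleton hy
  · rw [h0, add_zero]; exact h₁
  · refine .series h₁ hS fun v hv hv' => ?_
    rw [mem_add_iff] at hv
    simp only [Multiset.mem_singleton, exists_eq_left, Sym2.mem_iff] at hv
    obtain hv | rfl | rfl := hv
    · exact absurd (h v (mem_of_mem_costar hv) (mem_of_mem_costar hv') ▸ hv) not_mem_costar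
    · exact absurd (h v hxM (mem_of_mem_costar hv')) hcx.symm
    · rfl

/-- Elimination of a vertex of degree two other than the terminals. -/
theorem elim_internal (h : SP M a b) (hca : c ≠ a) (hcb : c ≠ b)
    (hs : star c M = {s(c, x), s(c, y)}) : SP (elim c x y M) a b := by
  induction h with
  | edge h =>
    have : star c {s(_, _)} = 0 := star_eq_zero (by simpa using ⟨hca, hcb⟩)
    rw [this] at hs
    simpa using congrArg Multiset.card hs
  | @series M N a d b hM hN h ihM ihN =>
    rw [star_add] at hs
    by_cases hcd : c = d
    · subst hcd
      obtain ⟨hx, hy⟩ | ⟨hx, hy⟩ := Multiset.add_eq_pair hs (card_star_pos hM.terminals.2.1)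
        (card_star_pos hN.terminals.1)
      · exact series_elim hM hN h hx hy
      · rw [elim, Sym2.eq_swap]
        exact series_elim hM hN h hx hy
    · by_cases hcM : ∃ e ∈ M, c ∈ e
      · have hcN : ¬ ∃ e ∈ N, c ∈ e := fun hcN => hcd (h c hcM hcN)
        rw [star_eq_zero hcN, add_zero] at hs
        rw [elim, costar_add, costar_eq_self hcN, ← Multiset.cons_add]
        exact .series (ihM hca hcd hs) hN fun v hv => h v (mem_of_mem_elim hs hv)
      · rw [star_eq_zero hcM, zero_add] at hs
        rw [elim, costar_add, costar_eq_self hcM, ← Multiset.add_cons]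
        exact .series hM (ihN hcd hcb hs) fun v hv hv' => h v hv (mem_of_mem_elim hs hv')
  | @parallel M N a b hM hN h ihM ihN =>
    rw [star_add] at hs
    by_cases hcM : ∃ e ∈ M, c ∈ e
    · have hcN : ¬ ∃ e ∈ N, c ∈ e := fun hcN => (h c hcM hcN).elim hca hcb
      rw [star_eq_zero hcN, add_zero] at hs
      rw [elim, costar_add, costar_eq_self hcN, ← Multiset.cons_add]
      exact .parallel (ihM hca hcb hs) hN fun v hv => h v (mem_of_mem_elim hs hv)
    · rw [star_eq_zero hcM, zero_add] at hs
      rw [elim, costar_add, costar_eq_self hcM, ← Multiset.add_cons]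
      exact .parallel hM (ihN hca hcb hs) fun v hv hv' => h v hv (mem_of_mem_elim hs hv')

/-- Parallel composition of two graphs in which the terminal `c` has degree one, after the
elimination of `c`. -/
theorem parallel_elim (hM : SP M c b) (hN : SP N c b)
    (h : ∀ v, (∃ e ∈ M, v ∈ e) → (∃ e ∈ N, v ∈ e) → v = c ∨ v = b) (hxy : x ≠ y)
    (hx : star c M = {s(c, x)}) (hy : star c N = {s(c, y)}) :
    ∃ z, SP (elim c x y (M + N)) z b := by
  have hxM : ∃ e ∈ M, x ∈ e := ⟨s(c, x), mem_of_star (by rw [hx]; simp), by simp⟩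
  have hyN : ∃ e ∈ N, y ∈ e := ⟨s(c, y), mem_of_star (by rw [hy]; simp), by simp⟩
  rw [elim, costar_add]
  obtain ⟨rfl, hM0⟩ | ⟨hxb, hSM⟩ := hM.costar_of_star_eq_singleton hx
  · obtain ⟨rfl, hN0⟩ | ⟨hyb, hSN⟩ := hN.costar_of_star_eq_singleton hy
    · exact absurd rfl hxy
    · refine ⟨y, ?_⟩
      rw [hM0, zero_add, ← Multiset.singleton_add, Sym2.eq_swap]
      exact .parallel (.edge hyb) hSN fun v hv _ => by simpa using hv
  · refine ⟨x, ?_⟩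
    have h₁ : SP ({s(x, y)} + costar c N) x b := by
      obtain ⟨rfl, hN0⟩ | ⟨hyb, hSN⟩ := hN.costar_of_star_eq_singleton hy
      · rw [hN0, add_zero]; exact .edge hxy
      · refine .series (.edge hxy) hSN fun v hv hv' => ?_
        simp only [Multiset.mem_singleton, exists_eq_left, Sym2.mem_iff] at hv
        obtain rfl | rfl := hv
        · obtain rfl | rfl := h v hxM (mem_of_mem_costar hv')
          · exact absurd hv' not_mem_costar
          · exact absurd rfl hxb
        · rfl
    rw [← Multiset.singleton_add, add_left_comm]
    refine .parallel hSM h₁ fun v hv hv' => ?_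
    rw [mem_add_iff] at hv'
    have hvc : v ≠ c := fun hvc => not_mem_costar (hvc ▸ hv)
    simp only [Multiset.mem_singleton, exists_eq_left, Sym2.mem_iff] at hv'
    obtain (rfl | rfl) | hv' := hv'
    · exact .inl rfl
    · exact .inr ((h v (mem_of_mem_costar hv) hyN).resolve_left hvc)
    · exact .inr ((h v (mem_of_mem_costar hv) (mem_of_mem_costar hv')).resolve_left hvc)

/-- Elimination of a terminal of degree two; one of its neighbours becomes a terminal. -/
theorem elim_terminal (h : SP M c b) (hxy : x ≠ y)
    (hs : star c M = {s(c, x), s(c, y)}) : ∃ z, SP (elim c x y M) z b := by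
  induction h with
  | @edge c b h =>
    have : Multiset.card (star c {s(c, b)}) ≤ 1 :=
      Multiset.card_le_card (Multiset.filter_le (c ∈ ·) {s(c, b)})
    rw [hs] at this
    simp at this
  | @series M N c d b hM hN h ihM ihN =>
    have hcN : ¬ ∃ e ∈ N, c ∈ e := fun hc => hM.ne (h c hM.terminals.1 hc)
    rw [star_add, star_eq_zero hcN, add_zero] at hs
    obtain ⟨z, hz⟩ := ihM hs
    rw [elim, costar_add, costar_eq_self hcN, ← Multiset.cons_add]
    exact ⟨z, .series hz hN fun v hv => h v (mem_of_mem_elim hs hv)⟩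
  | @parallel M N c b hM hN h ihM ihN =>
    rw [star_add] at hs
    obtain ⟨hx, hy⟩ | ⟨hx, hy⟩ := Multiset.add_eq_pair hs (card_star_pos hM.terminals.1)
      (card_star_pos hN.terminals.1)
    · exact parallel_elim hM hN h hxy hx hy
    · rw [elim, Sym2.eq_swap]
      exact parallel_elim hM hN h hxy.symm hx hy

theorem exists_elim (h : SP M a b) (hxy : x ≠ y) (hs : star c M = {s(c, x), s(c, y)}) :
    ∃ a b, SP (elim c x y M) a b := by
  by_cases hca : c = a
  · subst hca
    exact let ⟨z, hz⟩ := h.elim_terminal hxy hs; ⟨_, _, hz⟩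
  by_cases hcb : c = b
  · subst hcb
    exact let ⟨z, hz⟩ := h.symm.elim_terminal hxy hs; ⟨_, _, hz⟩
  exact ⟨_, _, h.elim_internal hca hcb hs⟩

/-- A series-parallel graph with more than one edge has two parallel edges, or a vertex of degree
two with distinct neighbours that is not a terminal. -/
theorem exists_reduction (h : SP M a b) : M = {s(a, b)} ∨ (∃ e, 2 ≤ M.count e) ∨
    ∃ c x y, x ≠ y ∧ c ≠ a ∧ c ≠ b ∧ star c M = {s(c, x), s(c, y)} := by
  induction h with
  | edge h => exact .inl rfl
  | @series M N a d b hM hN h ihM ihN =>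
    right
    have hab := (SP.series hM hN h).ne
    have had := hM.ne
    have hdb := hN.ne
    obtain rfl | ⟨e, he⟩ | ⟨c, x, y, hxy, hca, hcd, hs⟩ := ihM
    · obtain rfl | ⟨e, he⟩ | ⟨c, x, y, hxy, hcd, hcb, hs⟩ := ihN
      · refine .inr ⟨d, a, b, hab, had.symm, hdb, ?_⟩
        rw [Sym2.eq_swap, Multiset.singleton_add]
        exact Multiset.filter_eq_self.2 (by simp)
      · exact .inl ⟨e, he.trans (by rw [Multiset.count_add]; omega)⟩
      · have hcN : ∃ e ∈ N, c ∈ e := ⟨s(c, x), mem_of_star (by rw [hs]; simp), by simp⟩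
        have hcM : ¬ ∃ e ∈ ({s(a, d)} : Multiset (Sym2 V)), c ∈ e := fun hcM => hcd (h c hcM hcN)
        refine .inr ⟨c, x, y, hxy, ?_, hcb, by rw [star_add, star_eq_zero hcM, zero_add, hs]⟩
        rintro rfl
        exact hcM hM.terminals.1
    · exact .inl ⟨e, he.trans (by rw [Multiset.count_add]; omega)⟩
    · have hcM : ∃ e ∈ M, c ∈ e := ⟨s(c, x), mem_of_star (by rw [hs]; simp), by simp⟩
      have hcN : ¬ ∃ e ∈ N, c ∈ e := fun hcN => hcd (h c hcM hcN)
      refine .inr ⟨c, x, y, hxy, hca, ?_, by rw [star_add, star_eq_zero hcN, add_zero, hs]⟩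
      rintro rfl
      exact hcN hN.terminals.2.1
  | @parallel M N a b hM hN h ihM ihN =>
    right
    obtain rfl | ⟨e, he⟩ | ⟨c, x, y, hxy, hca, hcb, hs⟩ := ihM
    · obtain rfl | ⟨e, he⟩ | ⟨c, x, y, hxy, hca, hcb, hs⟩ := ihN
      · exact .inl ⟨s(a, b), by simp⟩
      · exact .inl ⟨e, he.trans (by rw [Multiset.count_add]; omega)⟩
      · have hcN : ∃ e ∈ N, c ∈ e := ⟨s(c, x), mem_of_star (by rw [hs]; simp), by simp⟩
        have hcM : ¬ ∃ e ∈ ({s(a, b)} : Multiset (Sym2 V)), c ∈ e :=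
          fun hcM => (h c hcM hcN).elim hca hcb
        exact .inr ⟨c, x, y, hxy, hca, hcb, by rw [star_add, star_eq_zero hcM, zero_add, hs]⟩
    · exact .inl ⟨e, he.trans (by rw [Multiset.count_add]; omega)⟩
    · have hcM : ∃ e ∈ M, c ∈ e := ⟨s(c, x), mem_of_star (by rw [hs]; simp), by simp⟩
      have hcN : ¬ ∃ e ∈ N, c ∈ e := fun hcN => (h c hcM hcN).elim hca hcb
      exact .inr ⟨c, x, y, hxy, hca, hcb, by rw [star_add, star_eq_zero hcN, add_zero, hs]⟩

end SP

/-! ### Maximum flows and minimum cuts -/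

namespace Network

variable {G : Network} {F : Finset (Fin G.m)} {f g : Fin G.m → ℝ}

/-- The capacity of the edges of `F` that join the two sides of the cut `σ`. -/
def cutCap (G : Network) (F : Finset (Fin G.m)) (σ : Fin G.n → Bool) : NNRat :=
  ∑ e ∈ F, if σ (G.ends e).1 ≠ σ (G.ends e).2 then G.cap e else 0

theorem netOut_add (v : Fin G.n) : G.netOut (f + g) v = G.netOut f v + G.netOut g v := by
  simp only [netOut, Pi.add_apply, Finset.sum_add_distrib]; ring

theorem netOut_smul (c : ℝ) (v : Fin G.n) : G.netOut (c • f) v = c * G.netOut f v := by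
  simp only [netOut, Pi.smul_apply, smul_eq_mul, ← Finset.mul_sum]; ring

theorem netOut_single (e : Fin G.m) (c : ℝ) (v : Fin G.n) :
    G.netOut (Pi.single e c) v =
      (if (G.ends e).1 = v then c else 0) - if (G.ends e).2 = v then c else 0 := by
  simp only [netOut, Finset.sum_filter]
  congr 1 <;>
  · rw [Finset.sum_eq_single e] <;> simp +contextual

theorem continuous_netOut (v : Fin G.n) : Continuous fun f => G.netOut f v := by
  unfold netOut; fun_prop

theorem sum_mul_netOut (χ : Fin G.n → ℝ) (f : Fin G.m → ℝ) :
    ∑ v, χ v * G.netOut f v = ∑ e, (χ (G.ends e).1 - χ (G.ends e).2) * f e := by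
  simp only [netOut, Finset.sum_filter, mul_sub, Finset.sum_sub_distrib, Finset.mul_sum, sub_mul]
  congr 1 <;>
  · rw [Finset.sum_comm]
    simp

theorem IsFlow.netOut_source (hf : G.IsFlow F f) {σ : Fin G.n → Bool} (hs : σ G.s = true)
    (ht : σ G.t = false) : G.netOut f G.s =
      ∑ e ∈ F, ((if σ (G.ends e).1 then 1 else 0) - if σ (G.ends e).2 then 1 else 0) * f e := by
  have h := sum_mul_netOut (fun v => if σ v then 1 else 0) f
  rw [Finset.sum_eq_single G.s] at h
  · rw [hs, if_pos rfl, one_mul] at h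
    rw [h]
    refine (Finset.sum_subset (Finset.subset_univ F) fun e _ he => ?_).symm
    rw [hf.eq_zero e he, mul_zero]
  · intro v _ hv
    by_cases hvt : v = G.t
    · simp [hvt, ht]
    · rw [hf.conserve v hv hvt, mul_zero]
  · simp

theorem IsFlow.netOut_le_cutCap (hf : G.IsFlow F f) {σ : Fin G.n → Bool} (hs : σ G.s = true)
    (ht : σ G.t = false) : G.netOut f G.s ≤ G.cutCap F σ := by
  rw [hf.netOut_source hs ht, cutCap, NNRat.cast_sum]
  refine Finset.sum_le_sum fun e he => ?_
  have := abs_le.1 (hf.le_cap e he)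
  cases σ (G.ends e).1 <;> cases σ (G.ends e).2 <;> simp <;> linarith

/-- `g` is a direction in which the flow `f` in `(V, F)` can be changed without violating the
capacities. -/
def IsDirection (G : Network) (F : Finset (Fin G.m)) (f g : Fin G.m → ℝ) : Prop :=
  ∀ e, (0 < g e → e ∈ F ∧ f e < G.cap e) ∧ (g e < 0 → e ∈ F ∧ -(G.cap e : ℝ) < f e)

theorem IsDirection.add {h : Fin G.m → ℝ} (hg : G.IsDirection F f g) (hh : G.IsDirection F f h) :
    G.IsDirection F f (g + h) := by
  intro e
  have h₁ := hg e
  have h₂ := hh e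
  rw [Pi.add_apply]
  constructor
  · intro h₃
    by_cases h₄ : 0 < g e
    · exact h₁.1 h₄
    · exact h₂.1 (by linarith)
  · intro h₃
    by_cases h₄ : g e < 0
    · exact h₁.2 h₄
    · exact h₂.2 (by linarith)

theorem IsDirection.exists_pos (hf : G.IsFlow F f) (hg : G.IsDirection F f g) :
    ∃ ε : ℝ, 0 < ε ∧ ∀ e ∈ F, |f e + ε * g e| ≤ G.cap e := by
  have key : ∀ᶠ ε : ℝ in nhdsWithin 0 (Set.Ioi 0), ∀ e, e ∈ F → |f e + ε * g e| ≤ G.cap e := by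
    rw [Filter.eventually_all]
    intro e
    by_cases he : e ∈ F
    swap
    · exact .of_forall fun ε h => absurd h he
    have hcap := abs_le.1 (hf.le_cap e he)
    have hcont : Filter.Tendsto (fun ε : ℝ => f e + ε * g e) (nhdsWithin 0 (Set.Ioi 0))
        (nhds (f e)) := by
      have : Continuous fun ε : ℝ => f e + ε * g e := by fun_prop
      simpa using (this.tendsto 0).mono_left nhdsWithin_le_nhds
    obtain h | h | h := lt_trichotomy (g e) 0
    · filter_upwards [hcont.eventually_const_lt ((hg e).2 h).2, self_mem_nhdsWithin] with ε h₁ h₂ _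
      have := mul_neg_of_pos_of_neg (Set.mem_Ioi.1 h₂) h
      exact abs_le.2 ⟨h₁.le, by linarith⟩
    · exact .of_forall fun ε _ => by simpa [h] using hf.le_cap e he
    · filter_upwards [hcont.eventually_lt_const ((hg e).1 h).2, self_mem_nhdsWithin] with ε h₁ h₂ _
      have := mul_pos (Set.mem_Ioi.1 h₂) h
      exact abs_le.2 ⟨by linarith, h₁.le⟩
  obtain ⟨ε, h₁, h₂⟩ := (key.and self_mem_nhdsWithin).exists
  exact ⟨ε, h₂, h₁⟩

theorem exists_isFlow_isMaxOn (G : Network) (F : Finset (Fin G.m)) :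
    ∃ f, G.IsFlow F f ∧ ∀ f', G.IsFlow F f' → G.netOut f' G.s ≤ G.netOut f G.s := by
  have hclosed : IsClosed {f | G.IsFlow F f} := by
    have : {f | G.IsFlow F f} = (⋂ e ∈ F, {f | |f e| ≤ (G.cap e : ℝ)}) ∩
        (⋂ e ∉ F, {f | f e = 0}) ∩
        ⋂ v, ⋂ (_ : v ≠ G.s), ⋂ (_ : v ≠ G.t), {f | G.netOut f v = 0} := by
      ext f
      simp only [Set.mem_inter_iff, Set.mem_iInter, Set.mem_ofPred_eq]
      exact ⟨fun h => ⟨⟨h.1, h.2⟩, h.3⟩, fun h => ⟨h.1.1, h.1.2, h.2⟩⟩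
    rw [this]
    refine .inter (.inter ?_ ?_) ?_
    · exact isClosed_biInter fun e _ => isClosed_le (by fun_prop) continuous_const
    · exact isClosed_biInter fun e _ => isClosed_eq (by fun_prop) continuous_const
    · exact isClosed_iInter fun v => isClosed_iInter fun _ => isClosed_iInter fun _ =>
        isClosed_eq (continuous_netOut v) continuous_const
  have hcompact : IsCompact {f | G.IsFlow F f} := by
    refine (isCompact_univ_pi fun e => isCompact_Icc (a := -(G.cap e : ℝ))
      (b := (G.cap e : ℝ))).of_isClosed_subset hclosed fun f hf e _ => ?_
    by_cases he : e ∈ F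
    · exact Set.mem_Icc.2 (abs_le.1 (hf.le_cap e he))
    · rw [hf.eq_zero e he]; simp [NNRat.cast_nonneg]
  have hne : {f | G.IsFlow F f}.Nonempty := ⟨0, fun e _ => by simp [NNRat.cast_nonneg], fun _ _ => rfl,
    fun v _ _ => by simp [netOut]⟩
  obtain ⟨f, hf, hmax⟩ := hcompact.exists_isMaxOn hne (continuous_netOut G.s).continuousOn
  exact ⟨f, hf, fun f' hf' => hmax hf'⟩

/-- Max-flow min-cut, in the form that some cut has the value of a maximum flow: take the vertices
that can be reached from the source in the residual graph.  A vertex `v` counts as reachable if a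
unit of flow can be sent from the source to `v` along an admissible direction. -/
theorem exists_cutCap_eq_of_isMaxOn (hf : G.IsFlow F f)
    (hmax : ∀ f', G.IsFlow F f' → G.netOut f' G.s ≤ G.netOut f G.s) :
    ∃ σ : Fin G.n → Bool, σ G.s = true ∧ σ G.t = false ∧ G.netOut f G.s = G.cutCap F σ := by
  classical
  let R : Fin G.n → Prop := fun v => ∃ g, G.IsDirection F f g ∧ ∀ u, G.netOut g u =
    (if G.s = u then 1 else 0) - if v = u then 1 else 0
  have hRs : R G.s := ⟨0, fun e => by simp, fun u => by simp [netOut]⟩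
  have hRt : ¬ R G.t := by
    rintro ⟨g, hg, hgn⟩
    obtain ⟨ε, hε, hεg⟩ := hg.exists_pos hf
    have hflow : G.IsFlow F (f + ε • g) := by
      refine ⟨fun e he => by simpa using hεg e he, fun e he => ?_, fun v hs ht => ?_⟩
      · have : g e = 0 := le_antisymm (not_lt.1 fun h => he ((hg e).1 h).1)
          (not_lt.1 fun h => he ((hg e).2 h).1)
        simp [hf.eq_zero e he, this]
      · rw [netOut_add, netOut_smul, hgn, hf.conserve v hs ht, if_neg hs.symm, if_neg ht.symm]
        simp
    have := hmax _ hflow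
    rw [netOut_add, netOut_smul, hgn, if_pos rfl, if_neg G.s_ne_t.symm] at this
    linarith
  have step : ∀ (u w : Fin G.n) (g : Fin G.m → ℝ), R u → G.IsDirection F f g →
      (∀ v, G.netOut g v = (if u = v then 1 else 0) - if w = v then 1 else 0) → R w := by
    rintro u w g ⟨h, hh, hhn⟩ hg hgn
    exact ⟨h + g, hh.add hg, fun v => by rw [netOut_add, hhn, hgn]; ring⟩
  have hs : (fun v => decide (R v)) G.s = true := decide_eq_true hRs
  have ht : (fun v => decide (R v)) G.t = false := decide_eq_false hRt
  refine ⟨fun v => decide (R v), hs, ht, ?_⟩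
  rw [hf.netOut_source (σ := fun v => decide (R v)) hs ht, cutCap, NNRat.cast_sum]
  refine Finset.sum_congr rfl fun e he => ?_
  have hcap := abs_le.1 (hf.le_cap e he)
  have hdir : ∀ c : ℝ, (0 < c → f e < G.cap e) → (c < 0 → -(G.cap e : ℝ) < f e) →
      G.IsDirection F f (Pi.single e c) := by
    intro c h₁ h₂ e'
    by_cases hee : e' = e
    · subst hee
      simpa using ⟨fun h => ⟨he, h₁ h⟩, fun h => ⟨he, h₂ h⟩⟩
    · simp [hee]
  by_cases h₁ : R (G.ends e).1 <;> by_cases h₂ : R (G.ends e).2 <;> simp [h₁, h₂]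
  · refine le_antisymm hcap.2 (not_lt.1 fun h => h₂ ?_)
    refine step _ _ (Pi.single e 1) h₁ (hdir 1 (fun _ => h) fun h => by norm_num at h)
      fun v => netOut_single e 1 v
  · rw [neg_eq_iff_eq_neg]
    refine le_antisymm (not_lt.1 fun h => h₁ ?_) hcap.1
    refine step _ _ (Pi.single e (-1)) h₂ (hdir (-1) (fun h => by norm_num at h) fun _ => h)
      fun v => ?_
    rw [netOut_single]
    split_ifs <;> ring

theorem maxFlow_le_cutCap {σ : Fin G.n → Bool} (hs : σ G.s = true) (ht : σ G.t = false) :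
    G.maxFlow F ≤ G.cutCap F σ := by
  obtain ⟨f, hf, -⟩ := G.exists_isFlow_isMaxOn F
  refine csSup_le ⟨_, f, hf, rfl⟩ ?_
  rintro x ⟨f, hf, rfl⟩
  exact hf.netOut_le_cutCap hs ht

theorem exists_maxFlow_eq_cutCap (G : Network) (F : Finset (Fin G.m)) :
    ∃ σ : Fin G.n → Bool, σ G.s = true ∧ σ G.t = false ∧ G.maxFlow F = G.cutCap F σ := by
  obtain ⟨f, hf, hmax⟩ := G.exists_isFlow_isMaxOn F
  obtain ⟨σ, hs, ht, h⟩ := exists_cutCap_eq_of_isMaxOn hf hmax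
  refine ⟨σ, hs, ht, h ▸ IsGreatest.csSup_eq ⟨⟨f, hf, rfl⟩, ?_⟩⟩
  rintro x ⟨f', hf', rfl⟩
  exact hmax f' hf'

end Network

/-! ### The dynamic program -/

/-- A row of a table describes a set of edges of a subgraph with two terminals: `φ a b` is the
minimum capacity of a cut of the subgraph that puts the first terminal on side `a` and the second
one on side `b`, where the source and the sink are on their sides unless they are terminals of the
subgraph; `cost` is the cost of the edges, and `edges` lists them. -/
structure Row where
  φ : Bool → Bool → ℤ
  cost : ℤ
  edges : List ℕ

instance : Enc Row :=
  ⟨fun r => enc ((r.φ false false, r.φ false true, r.φ true false, r.φ true true), r.cost, r.edges)⟩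

/-- A subgraph with terminals `x` and `y` that is represented by its table.  The set `A` of the
edges of the subgraph and the function `ψ`, which sends a set of edges to the minimum capacities of
cuts, are used in proofs only and are not presented to the machine. -/
structure SuperEdge where
  x : ℕ
  y : ℕ
  table : List Row
  A : Finset ℕ
  ψ : Finset ℕ → Bool → Bool → ℤ

instance : Enc SuperEdge := ⟨fun e => enc (e.x, e.y, e.table)⟩

/-- The minimum of `g` over the sides on which the vertex `c` may lie: the source `s` is on side
`true`, the sink `t` on side `false`. -/
def minSide (s t c : ℕ) (g : Bool → ℤ) : ℤ :=
  bif decide (c = s) then g true else bif decide (c = t) then g false else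
    min (g false) (g true)

/-- The row for the union of two sets of edges, for a composition of subgraphs that acts on the
capacities of cuts by `op`. -/
def Row.combine (op : (Bool → Bool → ℤ) → (Bool → Bool → ℤ) → Bool → Bool → ℤ)
    (r₁ r₂ : Row) : Row :=
  ⟨op r₁.φ r₂.φ, r₁.cost + r₂.cost, r₁.edges ++ r₂.edges⟩

/-- Add a row to a table unless the table has a row with the same capacities and at most the same
cost; rows with the same capacities that become superfluous are deleted. -/
def insertRow (T : List Row) (r : Row) : List Row :=
  bif T.any fun r' => decide (r'.φ = r.φ) && decide (r'.cost ≤ r.cost) then T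
  else r :: T.filter fun r' => !decide (r'.φ = r.φ)

/-- A table in which every row of the list `L` is dominated by a row, and in which rows have
different capacities. -/
def tableOf (L : List Row) : List Row := L.foldl insertRow []

/-- The table of a composition. -/
def combineTables (op : (Bool → Bool → ℤ) → (Bool → Bool → ℤ) → Bool → Bool → ℤ)
    (T₁ T₂ : List Row) : List Row :=
  tableOf (T₁.flatMap fun r₁ => T₂.map fun r₂ => Row.combine op r₁ r₂)

/-- Capacities of cuts under parallel composition. -/
def parOp (φ₁ φ₂ : Bool → Bool → ℤ) (a b : Bool) : ℤ := φ₁ a b + φ₂ a b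

/-- Capacities of cuts under series composition at the vertex `c`. -/
def serOp (s t c : ℕ) (φ₁ φ₂ : Bool → Bool → ℤ) (a b : Bool) : ℤ :=
  minSide s t c fun z => φ₁ a z + φ₂ z b

/-- The row for the same edges when the terminals of the subgraph are interchanged. -/
def Row.flip (r : Row) : Row := ⟨fun a b => r.φ b a, r.cost, r.edges⟩

namespace SuperEdge

/-- The same subgraph with the terminals interchanged. -/
def flip (e : SuperEdge) : SuperEdge :=
  ⟨e.y, e.x, e.table.map Row.flip, e.A, fun F a b => e.ψ F b a⟩

/-- Composition of two subgraphs. -/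
def combine (op : (Bool → Bool → ℤ) → (Bool → Bool → ℤ) → Bool → Bool → ℤ) (x y : ℕ)
    (e f : SuperEdge) : SuperEdge :=
  ⟨x, y, combineTables op e.table f.table, e.A ∪ f.A, fun F => op (e.ψ F) (f.ψ F)⟩

/-- The subgraph that consists of one edge. -/
def single (i u v : ℕ) (cap cost : ℤ) : SuperEdge :=
  ⟨u, v, tableOf [⟨fun _ _ => 0, 0, []⟩, ⟨fun a b => bif a == b then 0 else cap, cost, [i]⟩], {i},
    fun F a b => if i ∈ F then bif a == b then 0 else cap else 0⟩

end SuperEdge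

/-- Compose `e = (x, c)` and `f = (c, y)` if this is a parallel composition, or a series
composition at a vertex that meets none of the other subgraphs `R`. -/
def mergeAt (s t : ℕ) (e f : SuperEdge) (R : List SuperEdge) : List (List SuperEdge) :=
  bif decide (e.y = f.x) then
    bif decide (e.x = f.y) then [SuperEdge.combine parOp e.x e.y e f.flip :: R]
    else bif R.all fun g => !decide (g.x = e.y) && !decide (g.y = e.y) then
      [SuperEdge.combine (serOp s t e.y) e.x f.y e f :: R]
    else []
  else []

/-- All results of a composition of two members of a list of subgraphs. -/
def reductions (s t : ℕ) (L : List SuperEdge) : List (List SuperEdge) :=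
  L.picks.flatMap fun p => p.2.picks.flatMap fun q =>
    [p.1, p.1.flip].flatMap fun e => [q.1, q.1.flip].flatMap fun f => mergeAt s t e f q.2

/-- One reduction step; a list that admits no reduction is left as it is. -/
def reduceStep (s t : ℕ) (L : List SuperEdge) : List SuperEdge := (reductions s t L).headD L

section
variable {α β : Type} [Enc α] [Enc β]

namespace PolyFun

@[fun_prop]
theorem row_cost {f : α → Row} (hf : PolyFun f) : PolyFun fun x => (f x).cost :=
  comp (g := fun p : (ℤ × ℤ × ℤ × ℤ) × ℤ × List ℕ => p.2.1) (f := fun x =>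
    (((f x).φ false false, (f x).φ false true, (f x).φ true false, (f x).φ true true),
      (f x).cost, (f x).edges)) (by fun_prop) (hf.congr_enc fun _ => rfl)

@[fun_prop]
theorem row_edges {f : α → Row} (hf : PolyFun f) : PolyFun fun x => (f x).edges :=
  comp (g := fun p : (ℤ × ℤ × ℤ × ℤ) × ℤ × List ℕ => p.2.2) (f := fun x =>
    (((f x).φ false false, (f x).φ false true, (f x).φ true false, (f x).φ true true),
      (f x).cost, (f x).edges)) (by fun_prop) (hf.congr_enc fun _ => rfl)

@[fun_prop]
theorem row_φ {f : α → Row} (hf : PolyFun f) (a b : Bool) : PolyFun fun x => (f x).φ a b :=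
  comp (g := fun p : (ℤ × ℤ × ℤ × ℤ) × ℤ × List ℕ =>
      bif a then bif b then p.1.2.2.2 else p.1.2.2.1 else bif b then p.1.2.1 else p.1.1)
    (f := fun x =>
    (((f x).φ false false, (f x).φ false true, (f x).φ true false, (f x).φ true true),
      (f x).cost, (f x).edges)) (by fun_prop) (hf.congr_enc fun _ => rfl)
    |>.congr_enc fun _ => by cases a <;> cases b <;> rfl

theorem row_mk {φ : α → Bool → Bool → ℤ} {c : α → ℤ} {l : α → List ℕ}
    (hφ : ∀ a b, PolyFun fun x => φ x a b) (hc : PolyFun c) (hl : PolyFun l) :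
    PolyFun fun x => Row.mk (φ x) (c x) (l x) :=
  (((hφ false false).prodMk ((hφ false true).prodMk ((hφ true false).prodMk (hφ true true)))).prodMk
    (hc.prodMk hl)).congr_enc fun _ => rfl

@[fun_prop]
theorem row_φ_eq {f g : α → Row} (hf : PolyFun f) (hg : PolyFun g) :
    PolyFun fun x => decide ((f x).φ = (g x).φ) := by
  have : PolyFun fun x => decide ((f x).φ false false = (g x).φ false false) &&
      (decide ((f x).φ false true = (g x).φ false true) &&
      (decide ((f x).φ true false = (g x).φ true false) &&
      decide ((f x).φ true true = (g x).φ true true))) := by fun_prop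
  refine this.congr_enc fun x => congrArg enc ?_
  rw [← Bool.decide_and, ← Bool.decide_and, ← Bool.decide_and]
  simp [funext_iff, Bool.forall_bool, and_assoc]

@[fun_prop]
theorem superEdge_x {f : α → SuperEdge} (hf : PolyFun f) : PolyFun fun x => (f x).x :=
  comp (g := fun p : ℕ × ℕ × List Row => p.1) (f := fun x => ((f x).x, (f x).y, (f x).table))
    (by fun_prop) (hf.congr_enc fun _ => rfl)

@[fun_prop]
theorem superEdge_y {f : α → SuperEdge} (hf : PolyFun f) : PolyFun fun x => (f x).y :=
  comp (g := fun p : ℕ × ℕ × List Row => p.2.1) (f := fun x => ((f x).x, (f x).y, (f x).table))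
    (by fun_prop) (hf.congr_enc fun _ => rfl)

@[fun_prop]
theorem superEdge_table {f : α → SuperEdge} (hf : PolyFun f) : PolyFun fun x => (f x).table :=
  comp (g := fun p : ℕ × ℕ × List Row => p.2.2) (f := fun x => ((f x).x, (f x).y, (f x).table))
    (by fun_prop) (hf.congr_enc fun _ => rfl)

theorem superEdge_mk {x y : α → ℕ} {T : α → List Row} (hx : PolyFun x) (hy : PolyFun y)
    (hT : PolyFun T) (A : α → Finset ℕ) (ψ : α → Finset ℕ → Bool → Bool → ℤ) :
    PolyFun fun v => SuperEdge.mk (x v) (y v) (T v) (A v) (ψ v) :=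
  (hx.prodMk (hy.prodMk hT)).congr_enc fun _ => rfl

theorem minSide {s t c : α → ℕ} {g : α → Bool → ℤ} (hs : PolyFun s) (ht : PolyFun t)
    (hc : PolyFun c) (hg : ∀ z, PolyFun fun x => g x z) :
    PolyFun fun x => minSide (s x) (t x) (c x) (g x) := by
  have h₁ := hg true
  have h₂ := hg false
  unfold _root_.minSide
  fun_prop

theorem esize_insertRow_le (T : List Row) (r : Row) :
    esize (insertRow T r) ≤ esize T + (esize r + 1) := by
  unfold insertRow
  cases T.any _
  · have := esize_sublist (List.filter_sublist (p := fun r' => !decide (r'.φ = r.φ)) (l := T))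
    simp only [cond_false, esize_cons]
    omega
  · simp

@[fun_prop]
theorem tableOf {L : α → List Row} (hL : PolyFun L) : PolyFun fun x => tableOf (L x) := by
  unfold _root_.tableOf
  refine foldl_of_growth (s := fun _ => insertRow) (B := fun p => esize p.2 + 1) hL (const []) ?_
    ((PolyBdd.esize_comp (by fun_prop)).add (PolyBdd.const 1))
    fun _ T r => esize_insertRow_le T r
  unfold insertRow
  fun_prop

theorem combineTables {op : α → (Bool → Bool → ℤ) → (Bool → Bool → ℤ) → Bool → Bool → ℤ}
    (hop : ∀ a b, PolyFun fun p : α × Row × Row => op p.1 p.2.1.φ p.2.2.φ a b)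
    {T₁ T₂ : α → List Row} (h₁ : PolyFun T₁) (h₂ : PolyFun T₂) :
    PolyFun fun x => combineTables (op x) (T₁ x) (T₂ x) := by
  unfold _root_.combineTables
  refine tableOf (list_flatMap h₁ (list_map (by fun_prop) (row_mk (fun a b => ?_) ?_ ?_)))
  · exact (hop a b).comp (f := fun p : (α × Row) × Row => (p.1.1, p.1.2, p.2)) (by fun_prop)
  · fun_prop
  · fun_prop

@[fun_prop]
theorem superEdge_single {i u v : α → ℕ} {c k : α → ℤ} (hi : PolyFun i) (hu : PolyFun u)
    (hv : PolyFun v) (hc : PolyFun c) (hk : PolyFun k) :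
    PolyFun fun x => SuperEdge.single (i x) (u x) (v x) (c x) (k x) := by
  refine superEdge_mk hu hv (tableOf (list_cons (row_mk (fun a b => const 0) (const 0) (const []))
    (list_cons (row_mk (fun a b => ?_) hk (by fun_prop)) (const [])))) _ _
  fun_prop

@[fun_prop]
theorem superEdge_flip {f : α → SuperEdge} (hf : PolyFun f) : PolyFun fun x => (f x).flip :=
  superEdge_mk (x := fun v => (f v).y) (y := fun v => (f v).x)
    (T := fun v => (f v).table.map Row.flip) (by fun_prop) (by fun_prop)
    (list_map (by fun_prop) (row_mk (φ := fun p : α × Row => fun a b => p.2.φ b a)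
      (c := fun p => p.2.cost) (l := fun p => p.2.edges) (fun a b => by fun_prop) (by fun_prop)
      (by fun_prop))) (fun v => (f v).A) fun v F a b => (f v).ψ F b a

theorem superEdge_combine {op : α → (Bool → Bool → ℤ) → (Bool → Bool → ℤ) → Bool → Bool → ℤ}
    (hop : ∀ a b, PolyFun fun p : α × Row × Row => op p.1 p.2.1.φ p.2.2.φ a b) {x y : α → ℕ}
    {e f : α → SuperEdge} (hx : PolyFun x) (hy : PolyFun y) (he : PolyFun e) (hf : PolyFun f) :
    PolyFun fun v => SuperEdge.combine (op v) (x v) (y v) (e v) (f v) :=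
  superEdge_mk hx hy (combineTables hop he.superEdge_table hf.superEdge_table) _ _

@[fun_prop]
theorem mergeAt {s t : α → ℕ} {e f : α → SuperEdge} {R : α → List SuperEdge} (hs : PolyFun s)
    (ht : PolyFun t) (he : PolyFun e) (hf : PolyFun f) (hR : PolyFun R) :
    PolyFun fun x => mergeAt (s x) (t x) (e x) (f x) (R x) := by
  have h₁ : PolyFun fun x => SuperEdge.combine parOp (e x).x (e x).y (e x) (f x).flip :=
    superEdge_combine (fun a b => by unfold parOp; fun_prop) (by fun_prop) (by fun_prop)
      (by fun_prop) (by fun_prop)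
  have h₂ : PolyFun fun x =>
      SuperEdge.combine (serOp (s x) (t x) (e x).y) (e x).x (f x).y (e x) (f x) :=
    superEdge_combine (fun a b => minSide (by fun_prop) (by fun_prop) (by fun_prop)
      fun z => by fun_prop) (by fun_prop) (by fun_prop) (by fun_prop) (by fun_prop)
  unfold _root_.mergeAt
  fun_prop

@[fun_prop]
theorem reduceStep {s t : α → ℕ} {L : α → List SuperEdge} (hs : PolyFun s)
    (ht : PolyFun t) (hL : PolyFun L) : PolyFun fun x => reduceStep (s x) (t x) (L x) := by
  unfold _root_.reduceStep reductions
  fun_prop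

end PolyFun
end

/-! ### Correctness of the reductions -/

theorem mem_insertRow {T : List Row} {r r' : Row} (h : r' ∈ insertRow T r) : r' ∈ T ∨ r' = r := by
  unfold insertRow at h
  cases hc : T.any fun r' => decide (r'.φ = r.φ) && decide (r'.cost ≤ r.cost)
  · rw [hc, cond_false, List.mem_cons] at h
    exact h.symm.imp_left List.mem_of_mem_filter
  · rw [hc, cond_true] at h
    exact .inl h

theorem exists_mem_insertRow {T : List Row} {r r' : Row} (h : r' ∈ T ∨ r' = r) :
    ∃ r'' ∈ insertRow T r, r''.φ = r'.φ ∧ r''.cost ≤ r'.cost := by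
  unfold insertRow
  cases hc : T.any fun r' => decide (r'.φ = r.φ) && decide (r'.cost ≤ r.cost)
  · rw [cond_false]
    simp only [List.any_eq_false, Bool.and_eq_true, decide_eq_true_eq, not_and, not_le] at hc
    obtain h | rfl := h
    · by_cases h₁ : r'.φ = r.φ
      · exact ⟨r, by simp, h₁.symm, (hc r' h h₁).le⟩
      · exact ⟨r', by simp [h, h₁], rfl, le_rfl⟩
    · exact ⟨r', by simp, rfl, le_rfl⟩
  · rw [cond_true]
    obtain h | rfl := h
    · exact ⟨r', h, rfl, le_rfl⟩
    · simpa [List.any_eq_true] using hc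

theorem nodup_insertRow {T : List Row} (h : (T.map Row.φ).Nodup) (r : Row) :
    ((insertRow T r).map Row.φ).Nodup := by
  unfold insertRow
  cases T.any fun r' => decide (r'.φ = r.φ) && decide (r'.cost ≤ r.cost)
  · rw [cond_false, List.map_cons, List.nodup_cons]
    exact ⟨by simp, h.sublist (List.filter_sublist.map _)⟩
  · exact h

theorem mem_foldl_insertRow {L T : List Row} {r : Row} (h : r ∈ L.foldl insertRow T) :
    r ∈ T ∨ r ∈ L := by
  induction L generalizing T with
  | nil => exact .inl h
  | cons a L ih =>
    obtain h | h := ih h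
    · obtain h | rfl := mem_insertRow h
      · exact .inl h
      · exact .inr (by simp)
    · exact .inr (by simp [h])

theorem exists_mem_foldl_insertRow {L T : List Row} {r : Row} (h : r ∈ T ∨ r ∈ L) :
    ∃ r' ∈ L.foldl insertRow T, r'.φ = r.φ ∧ r'.cost ≤ r.cost := by
  induction L generalizing T r with
  | nil => exact ⟨r, by simpa using h, rfl, le_rfl⟩
  | cons a L ih =>
    have key : (r ∈ T ∨ r = a) → ∃ r' ∈ (a :: L).foldl insertRow T, r'.φ = r.φ ∧
        r'.cost ≤ r.cost := fun h => by
      obtain ⟨r₁, h₁, hφ₁, hc₁⟩ := exists_mem_insertRow h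
      obtain ⟨r₂, h₂, hφ₂, hc₂⟩ := ih (T := insertRow T a) (.inl h₁)
      exact ⟨r₂, h₂, hφ₂.trans hφ₁, hc₂.trans hc₁⟩
    obtain h | h := h
    · exact key (.inl h)
    · obtain rfl | h := List.mem_cons.1 h
      · exact key (.inr rfl)
      · exact ih (.inr h)

theorem nodup_foldl_insertRow {L T : List Row} (h : (T.map Row.φ).Nodup) :
    ((L.foldl insertRow T).map Row.φ).Nodup := by
  induction L generalizing T with
  | nil => exact h
  | cons a L ih => exact ih (nodup_insertRow h a)

theorem mem_of_mem_tableOf {L : List Row} {r : Row} (h : r ∈ tableOf L) : r ∈ L :=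
  (mem_foldl_insertRow h).resolve_left (by simp)

theorem exists_mem_tableOf {L : List Row} {r : Row} (h : r ∈ L) :
    ∃ r' ∈ tableOf L, r'.φ = r.φ ∧ r'.cost ≤ r.cost :=
  exists_mem_foldl_insertRow (.inr h)

theorem nodup_tableOf (L : List Row) : ((tableOf L).map Row.φ).Nodup :=
  nodup_foldl_insertRow (by simp)

/-- The table of `e` is correct: its rows describe sets of edges of `e`, and every set of edges of
`e` is dominated by a row.  Moreover `ψ F` only depends on the edges of `e` in `F`, and its values
are capacities of sets of edges of `e`. -/
structure SuperEdge.Valid (cap cost : ℕ → ℤ) (e : SuperEdge) : Prop where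
  sound : ∀ r ∈ e.table, r.edges.Nodup ∧ r.edges.toFinset ⊆ e.A ∧
    r.φ = e.ψ r.edges.toFinset ∧ r.cost = ∑ i ∈ r.edges.toFinset, cost i
  complete : ∀ F ⊆ e.A, ∃ r ∈ e.table, r.φ = e.ψ F ∧ r.cost ≤ ∑ i ∈ F, cost i
  nodup : (e.table.map Row.φ).Nodup
  inter : ∀ F, e.ψ (F ∩ e.A) = e.ψ F
  sum : ∀ F a b, ∃ S ⊆ e.A, e.ψ F a b = ∑ i ∈ S, cap i

namespace SuperEdge.Valid

variable {cap cost : ℕ → ℤ} {e f : SuperEdge}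

theorem single (i u v : ℕ) (hcost : 0 ≤ cost i) :
    (SuperEdge.single i u v (cap i) (cost i)).Valid cap cost where
  sound r hr := by
    have hr := mem_of_mem_tableOf hr
    simp only [List.mem_cons, List.not_mem_nil, or_false] at hr
    obtain rfl | rfl := hr <;> simp [SuperEdge.single]
  complete F hF := by
    by_cases hi : i ∈ F
    · obtain ⟨r, hr, hφ, hc⟩ := exists_mem_tableOf (List.mem_cons_of_mem
        (⟨fun _ _ => 0, 0, []⟩ : Row) (List.mem_singleton_self
          (⟨fun a b => bif a == b then 0 else cap i, cost i, [i]⟩ : Row)))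
      refine ⟨r, hr, by simp [hφ, SuperEdge.single, hi], hc.trans ?_⟩
      exact Finset.single_le_sum (f := cost) (fun j hj => by
        rw [Finset.mem_singleton.1 (hF hj)]; exact hcost) hi
    · obtain ⟨r, hr, hφ, hc⟩ := exists_mem_tableOf (List.mem_cons_self
        (a := (⟨fun _ _ => 0, 0, []⟩ : Row))
        (l := [⟨fun a b => bif a == b then 0 else cap i, cost i, [i]⟩]))
      refine ⟨r, hr, by simp [hφ, SuperEdge.single, hi], hc.trans ?_⟩
      exact Finset.sum_nonneg fun j hj => by rw [Finset.mem_singleton.1 (hF hj)]; exact hcost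
  nodup := nodup_tableOf _
  inter F := by
    simp [SuperEdge.single]
  sum F a b := by
    by_cases hi : i ∈ F ∧ a ≠ b
    · exact ⟨{i}, by simp [SuperEdge.single], by
        simp [SuperEdge.single, hi.1, beq_false_of_ne hi.2]⟩
    · refine ⟨∅, by simp, ?_⟩
      simp only [SuperEdge.single, Finset.sum_empty]
      grind

theorem flip (h : e.Valid cap cost) : e.flip.Valid cap cost where
  sound r hr := by
    obtain ⟨r, hr, rfl⟩ := List.mem_map.1 hr
    have ⟨h₁, h₂, h₃, h₄⟩ := h.sound r ‹_›
    exact ⟨h₁, h₂, by simp only [Row.flip, SuperEdge.flip, h₃], h₄⟩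
  complete F hF := by
    obtain ⟨r, hr, hφ, hc⟩ := h.complete F hF
    exact ⟨r.flip, List.mem_map_of_mem hr, by simp only [Row.flip, SuperEdge.flip, hφ], hc⟩
  nodup := by
    have : e.flip.table.map Row.φ = (e.table.map Row.φ).map fun φ a b => φ b a := by
      simp [SuperEdge.flip, Row.flip, Function.comp_def]
    rw [this]
    exact h.nodup.map fun φ φ' hφ => by
      ext a b
      exact congrFun (congrFun hφ b) a
  inter F := by simp only [SuperEdge.flip, h.inter]
  sum F a b := h.sum F b a

theorem combine (he : e.Valid cap cost) (hf : f.Valid cap cost) (hd : Disjoint e.A f.A)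
    {op : (Bool → Bool → ℤ) → (Bool → Bool → ℤ) → Bool → Bool → ℤ}
    (hop : ∀ φ₁ φ₂ a b, ∃ a₁ b₁ a₂ b₂, op φ₁ φ₂ a b = φ₁ a₁ b₁ + φ₂ a₂ b₂) (x y : ℕ) :
    (e.combine op x y f).Valid cap cost where
  sound r hr := by
    obtain ⟨r₁, hr₁, hr⟩ := List.mem_flatMap.1 (mem_of_mem_tableOf hr)
    obtain ⟨r₂, hr₂, rfl⟩ := List.mem_map.1 hr
    obtain ⟨h₁, h₂, h₃, h₄⟩ := he.sound r₁ hr₁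
    obtain ⟨k₁, k₂, k₃, k₄⟩ := hf.sound r₂ hr₂
    have hd' := Finset.disjoint_of_subset_left h₂ (Finset.disjoint_of_subset_right k₂ hd)
    simp only [Row.combine, SuperEdge.combine, List.toFinset_append]
    refine ⟨h₁.append k₁ (by rwa [List.disjoint_toFinset_iff_disjoint] at hd'),
      Finset.union_subset_union h₂ k₂, ?_, by rw [Finset.sum_union hd', h₄, k₄]⟩
    rw [h₃, k₃, ← he.inter (_ ∪ _), ← hf.inter (_ ∪ _), Finset.union_inter_distrib_right,
      Finset.union_inter_distrib_right, Finset.inter_eq_left.2 h₂, Finset.inter_eq_left.2 k₂,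
      Finset.disjoint_iff_inter_eq_empty.1 (Finset.disjoint_of_subset_left k₂ hd.symm),
      Finset.disjoint_iff_inter_eq_empty.1 (Finset.disjoint_of_subset_left h₂ hd),
      Finset.union_empty, Finset.empty_union]
  complete F hF := by
    obtain ⟨r₁, hr₁, hφ₁, hc₁⟩ := he.complete (F ∩ e.A) Finset.inter_subset_right
    obtain ⟨r₂, hr₂, hφ₂, hc₂⟩ := hf.complete (F ∩ f.A) Finset.inter_subset_right
    obtain ⟨r, hr, hφ, hc⟩ := exists_mem_tableOf (r := Row.combine op r₁ r₂)
      (L := e.table.flatMap fun r₁ => f.table.map fun r₂ => Row.combine op r₁ r₂)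
      (List.mem_flatMap.2 ⟨r₁, hr₁, List.mem_map_of_mem hr₂⟩)
    refine ⟨r, hr, ?_, hc.trans ?_⟩
    · rw [hφ, Row.combine, hφ₁, hφ₂, he.inter, hf.inter, SuperEdge.combine]
    · have : F = F ∩ e.A ∪ F ∩ f.A := by
        rw [← Finset.inter_union_distrib_left]; exact (Finset.inter_eq_left.2 hF).symm
      rw [this, Finset.sum_union (Finset.disjoint_of_subset_left Finset.inter_subset_right
        (Finset.disjoint_of_subset_right Finset.inter_subset_right hd))]
      exact add_le_add hc₁ hc₂
  nodup := nodup_tableOf _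
  inter F := by
    simp only [SuperEdge.combine]
    rw [← he.inter (F ∩ _), ← hf.inter (F ∩ _), Finset.inter_assoc, Finset.inter_assoc,
      Finset.inter_eq_right.2 Finset.subset_union_left,
      Finset.inter_eq_right.2 Finset.subset_union_right, he.inter, hf.inter]
  sum F a b := by
    obtain ⟨a₁, b₁, a₂, b₂, h⟩ := hop (e.ψ F) (f.ψ F) a b
    obtain ⟨S₁, h₁, hS₁⟩ := he.sum F a₁ b₁
    obtain ⟨S₂, h₂, hS₂⟩ := hf.sum F a₂ b₂
    refine ⟨S₁ ∪ S₂, Finset.union_subset_union h₁ h₂, ?_⟩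
    rw [Finset.sum_union (Finset.disjoint_of_subset_left h₁
      (Finset.disjoint_of_subset_right h₂ hd)), ← hS₁, ← hS₂]
    exact h

end SuperEdge.Valid

theorem minSide_le {s t c : ℕ} {g : Bool → ℤ} {z : Bool} (hs : c = s → z = true)
    (ht : c = t → z = false) : minSide s t c g ≤ g z := by
  unfold minSide
  by_cases h₁ : c = s
  · simp [h₁, hs h₁]
  by_cases h₂ : c = t
  · rw [ht h₂]
    simp [h₂]
    grind
  · cases z <;> simp [h₁, h₂]

theorem exists_minSide_eq {s t : ℕ} (hst : s ≠ t) (c : ℕ) (g : Bool → ℤ) :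
    ∃ z, (c = s → z = true) ∧ (c = t → z = false) ∧ minSide s t c g = g z := by
  unfold minSide
  by_cases h₁ : c = s
  · exact ⟨true, by simp, fun h₂ => absurd (h₁.symm.trans h₂) hst, by simp [h₁]⟩
  by_cases h₂ : c = t
  · exact ⟨false, by simp [h₁], by simp, by simp [h₂]; grind⟩
  · simp only [h₁, h₂, decide_false, cond_false, IsEmpty.forall_iff, true_and]
    obtain h | h := min_choice (g false) (g true)
    · exact ⟨false, h⟩
    · exact ⟨true, h⟩

/-- `σ` puts the source and the sink on their sides. -/
def Admissible (s t : ℕ) (σ : ℕ → Bool) : Prop := σ s = true ∧ σ t = false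

/-- The sum over the subgraphs in `L` of the minimum capacity, within the edges `F`, of a cut of the
subgraph that puts its terminals on the sides given by `σ`. -/
def cutSum (F : Finset ℕ) (σ : ℕ → Bool) (L : List SuperEdge) : ℤ :=
  (L.map fun e => e.ψ F (σ e.x) (σ e.y)).sum

/-- The edges of the graph whose edges are the members of `L`. -/
def edgeMultiset (L : List SuperEdge) : Multiset (Sym2 ℕ) := ↑(L.map fun e => s(e.x, e.y))

/-- What is known about a list `L` of subgraphs that arises by reductions from a network with
vertices `0, …, n - 1` and edges `0, …, m - 1`, where `val F σ` is the capacity of the cut `σ` in the graph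
with edge set `F`.  By `le` and `ge`, minima over admissible cuts of `cutSum F σ L` and of `val F σ`
agree; the reductions change the side of eliminated vertices only. -/
structure Invariant (s t n m : ℕ) (cap cost : ℕ → ℤ) (val : Finset ℕ → (ℕ → Bool) → ℤ)
    (L : List SuperEdge) : Prop where
  valid : ∀ e ∈ L, e.Valid cap cost
  disjoint : L.Pairwise fun e f => Disjoint e.A f.A
  cover : ∀ i, i < m ↔ ∃ e ∈ L, i ∈ e.A
  lt : ∀ e ∈ L, e.x < n ∧ e.y < n
  sp : ∃ a b, SP (edgeMultiset L) a b
  le : ∀ F σ, Admissible s t σ → ∃ σ', Admissible s t σ' ∧ cutSum F σ' L ≤ val F σ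
  ge : ∀ F σ, Admissible s t σ → ∃ σ', Admissible s t σ' ∧ val F σ' ≤ cutSum F σ L

theorem cutSum_cons (F : Finset ℕ) (σ : ℕ → Bool) (e : SuperEdge) (L : List SuperEdge) :
    cutSum F σ (e :: L) = e.ψ F (σ e.x) (σ e.y) + cutSum F σ L := by simp [cutSum]

theorem edgeMultiset_cons (e : SuperEdge) (L : List SuperEdge) :
    edgeMultiset (e :: L) = s(e.x, e.y) ::ₘ edgeMultiset L := rfl

theorem mem_edgeMultiset {L : List SuperEdge} {p : Sym2 ℕ} :
    p ∈ edgeMultiset L ↔ ∃ e ∈ L, s(e.x, e.y) = p := by simp [edgeMultiset]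

namespace Invariant

variable {s t n m : ℕ} {cap cost : ℕ → ℤ} {val : Finset ℕ → (ℕ → Bool) → ℤ} {L R : List SuperEdge}
  {e f : SuperEdge}

theorem perm (h : Invariant s t n m cap cost val L) (hp : L.Perm R) :
    Invariant s t n m cap cost val R where
  valid e he := h.valid e (hp.mem_iff.2 he)
  disjoint := (hp.pairwise_iff fun h => h.symm).1 h.disjoint
  cover i := by simp only [h.cover, hp.mem_iff]
  lt e he := h.lt e (hp.mem_iff.2 he)
  sp := by
    have : edgeMultiset R = edgeMultiset L := (Multiset.coe_eq_coe.2 (hp.map _)).symm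
    rw [this]; exact h.sp
  le F σ hσ := by
    have : ∀ σ, cutSum F σ R = cutSum F σ L := fun σ => (hp.map _).sum_eq.symm
    simpa only [this] using h.le F σ hσ
  ge F σ hσ := by
    have : ∀ σ, cutSum F σ R = cutSum F σ L := fun σ => (hp.map _).sum_eq.symm
    simpa only [this] using h.ge F σ hσ

theorem flip (h : Invariant s t n m cap cost val (e :: L)) :
    Invariant s t n m cap cost val (e.flip :: L) where
  valid := by
    simp only [List.forall_mem_cons]
    exact ⟨(h.valid e (by simp)).flip, fun g hg => h.valid g (by simp [hg])⟩
  disjoint := by simpa [List.pairwise_cons, SuperEdge.flip] using h.disjoint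
  cover i := by simp [h.cover, SuperEdge.flip]
  lt := by
    simp only [List.forall_mem_cons]
    exact ⟨(h.lt e (by simp)).symm, fun g hg => h.lt g (by simp [hg])⟩
  sp := by simpa [edgeMultiset_cons, SuperEdge.flip, Sym2.eq_swap] using h.sp
  le F σ hσ := by simpa [cutSum_cons, SuperEdge.flip] using h.le F σ hσ
  ge F σ hσ := by simpa [cutSum_cons, SuperEdge.flip] using h.ge F σ hσ

/-- A composition keeps the invariant if it keeps the graph series-parallel and does not change the
minimum capacities of cuts. -/
theorem combine (h : Invariant s t n m cap cost val (e :: f :: R))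
    {op : (Bool → Bool → ℤ) → (Bool → Bool → ℤ) → Bool → Bool → ℤ}
    (hop : ∀ φ₁ φ₂ a b, ∃ a₁ b₁ a₂ b₂, op φ₁ φ₂ a b = φ₁ a₁ b₁ + φ₂ a₂ b₂) {x y : ℕ}
    (hx : x < n) (hy : y < n) (hsp : ∃ a b, SP (s(x, y) ::ₘ edgeMultiset R) a b)
    (hle : ∀ F σ, Admissible s t σ → ∃ σ', Admissible s t σ' ∧
      cutSum F σ' (e.combine op x y f :: R) ≤ cutSum F σ (e :: f :: R))
    (hge : ∀ F σ, Admissible s t σ → ∃ σ', Admissible s t σ' ∧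
      cutSum F σ' (e :: f :: R) ≤ cutSum F σ (e.combine op x y f :: R)) :
    Invariant s t n m cap cost val (e.combine op x y f :: R) := by
  have hd := h.disjoint
  simp only [List.pairwise_cons, List.forall_mem_cons] at hd
  refine ⟨?_, ?_, fun i => ?_, ?_, hsp, fun F σ hσ => ?_, fun F σ hσ => ?_⟩
  · simp only [List.forall_mem_cons]
    exact ⟨(h.valid e (by simp)).combine (h.valid f (by simp)) hd.1.1 hop x y,
      fun g hg => h.valid g (by simp [hg])⟩
  · rw [List.pairwise_cons]
    exact ⟨fun g hg => Finset.disjoint_union_left.2 ⟨hd.1.2 g hg, hd.2.1 g hg⟩, hd.2.2⟩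
  · simp [h.cover, SuperEdge.combine, or_assoc]
  · simp only [List.forall_mem_cons]
    exact ⟨⟨hx, hy⟩, fun g hg => h.lt g (by simp [hg])⟩
  · obtain ⟨σ', hσ', h₁⟩ := h.le F σ hσ
    obtain ⟨σ'', hσ'', h₂⟩ := hle F σ' hσ'
    exact ⟨σ'', hσ'', h₂.trans h₁⟩
  · obtain ⟨σ', hσ', h₁⟩ := hge F σ hσ
    obtain ⟨σ'', hσ'', h₂⟩ := h.ge F σ' hσ'
    exact ⟨σ'', hσ'', h₂.trans h₁⟩

/-- Parallel composition of two subgraphs with the same terminals. -/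
theorem parallel (h : Invariant s t n m cap cost val (e :: f :: R)) (hx : e.x = f.x)
    (hy : e.y = f.y) : Invariant s t n m cap cost val (e.combine parOp e.x e.y f :: R) := by
  have hc : ∀ F σ, cutSum F σ (e.combine parOp e.x e.y f :: R) = cutSum F σ (e :: f :: R) :=
    fun F σ => by simp only [cutSum_cons, SuperEdge.combine, parOp, ← hx, ← hy, add_assoc]
  refine h.combine (fun φ₁ φ₂ a b => ⟨a, b, a, b, rfl⟩) (h.lt e (by simp)).1
    (h.lt e (by simp)).2 ?_
    (fun F σ hσ => ⟨σ, hσ, (hc F σ).le⟩) (fun F σ hσ => ⟨σ, hσ, (hc F σ).ge⟩)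
  obtain ⟨a, b, hS⟩ := h.sp
  rw [edgeMultiset_cons, edgeMultiset_cons, ← hx, ← hy] at hS
  have := hS.erase_of_two_le_count (e := s(e.x, e.y)) (by simp)
  exact ⟨a, b, by simpa using this⟩

/-- Series composition at a vertex that meets no other subgraph: the minimum over the side of this
vertex can be taken first. -/
theorem series (h : Invariant s t n m cap cost val (e :: f :: R)) (hst : s ≠ t) (hc : e.y = f.x)
    (hne : e.x ≠ f.y) (hR : ∀ g ∈ R, g.x ≠ e.y ∧ g.y ≠ e.y) :
    Invariant s t n m cap cost val (e.combine (serOp s t e.y) e.x f.y f :: R) := by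
  obtain ⟨a, b, hS⟩ := h.sp
  have hex : e.x ≠ e.y := by simpa using hS.not_isDiag s(e.x, e.y) (by simp [edgeMultiset_cons])
  have hfy : f.y ≠ e.y := by
    rw [hc]
    simpa [eq_comm] using hS.not_isDiag s(f.x, f.y) (by simp [edgeMultiset_cons])
  have hcR : ¬ ∃ p ∈ edgeMultiset R, e.y ∈ p := by
    rintro ⟨p, hp, hcp⟩
    obtain ⟨g, hg, rfl⟩ := mem_edgeMultiset.1 hp
    obtain h | h := Sym2.mem_iff.1 hcp
    · exact (hR g hg).1 h.symm
    · exact (hR g hg).2 h.symm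
  -- a change of the side of the vertex `e.y` does not affect the other subgraphs
  have hup : ∀ F σ z, cutSum F (Function.update σ e.y z) R = cutSum F σ R := fun F σ z => by
    refine congrArg List.sum (List.map_congr_left fun g hg => ?_)
    rw [Function.update_of_ne (hR g hg).1, Function.update_of_ne (hR g hg).2]
  refine h.combine (fun φ₁ φ₂ a b => ?_) (h.lt e (by simp)).1 (h.lt f (by simp)).2 ?_
    (fun F σ hσ => ⟨σ, hσ, ?_⟩) (fun F σ hσ => ?_)
  · obtain ⟨z, -, -, hz⟩ := exists_minSide_eq hst e.y fun z => φ₁ a z + φ₂ z b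
    exact ⟨a, z, z, b, hz⟩
  · refine hS.exists_elim (c := e.y) hne ?_ |>.imp fun a h => h.imp fun b h => ?_
    · simp only [edgeMultiset_cons, ← hc]
      rw [SP.star, Multiset.filter_cons_of_pos _ (by simp), Multiset.filter_cons_of_pos _ (by simp),
        ← SP.star, SP.star_eq_zero hcR, Sym2.eq_swap]
      rfl
    · simp only [edgeMultiset_cons, ← hc, SP.elim] at h
      rwa [SP.costar, Multiset.filter_cons_of_neg _ (by simp),
        Multiset.filter_cons_of_neg _ (by simp), ← SP.costar, SP.costar_eq_self hcR] at h
  · simp only [cutSum_cons, SuperEdge.combine, serOp, ← add_assoc, ← hc]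
    refine add_le_add_left (minSide_le (g := fun z => e.ψ F (σ e.x) z + f.ψ F z (σ f.y))
      (z := σ e.y) ?_ ?_) _
    · intro h; rw [h]; exact hσ.1
    · intro h; rw [h]; exact hσ.2
  · obtain ⟨z, hz₁, hz₂, hz⟩ :=
      exists_minSide_eq hst e.y fun z => e.ψ F (σ e.x) z + f.ψ F z (σ f.y)
    refine ⟨Function.update σ e.y z, ⟨?_, ?_⟩, ?_⟩
    · by_cases hs : s = e.y
      · rw [hs, Function.update_self]; exact hz₁ hs.symm
      · rw [Function.update_of_ne hs]; exact hσ.1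
    · by_cases ht : t = e.y
      · rw [ht, Function.update_self]; exact hz₂ ht.symm
      · rw [Function.update_of_ne ht]; exact hσ.2
    · simp only [cutSum_cons, hup, ← hc, Function.update_self, Function.update_of_ne hex,
        Function.update_of_ne hfy, SuperEdge.combine, serOp, hz, add_assoc, le_refl]

theorem mergeAt (h : Invariant s t n m cap cost val (e :: f :: R)) (hst : s ≠ t)
    (hL : L ∈ mergeAt s t e f R) :
    Invariant s t n m cap cost val L ∧ L.length = R.length + 1 := by
  unfold _root_.mergeAt at hL
  by_cases hc : e.y = f.x
  swap
  · simp [hc] at hL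
  by_cases hxy : e.x = f.y
  · simp only [hc, hxy, decide_true, cond_true, List.mem_singleton] at hL
    have h' := (((h.perm (.swap _ _ _)).flip).perm (.swap _ _ _)).parallel hxy hc
    rw [hc, hxy] at h'
    subst hL
    exact ⟨h', rfl⟩
  · simp only [hc, hxy, decide_true, decide_false, cond_true, cond_false] at hL
    cases hR : R.all fun g => !decide (g.x = f.x) && !decide (g.y = f.x)
    · simp [hR] at hL
    · rw [hR, cond_true, List.mem_singleton] at hL
      simp only [List.all_eq_true, Bool.and_eq_true, Bool.not_eq_true', decide_eq_false_iff_not]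
        at hR
      have h' := h.series hst hc hxy (by rwa [hc])
      rw [hc] at h'
      subst hL
      exact ⟨h', rfl⟩

theorem of_mem_reductions (h : Invariant s t n m cap cost val L) (hst : s ≠ t)
    {L' : List SuperEdge} (hL : L' ∈ reductions s t L) :
    Invariant s t n m cap cost val L' ∧ L'.length + 1 = L.length := by
  simp only [reductions, List.mem_flatMap, Prod.exists] at hL
  obtain ⟨e, R₁, he, f, R, hf, e', he', f', hf', hL⟩ := hL
  have hp : L.Perm (e :: f :: R) :=
    (List.perm_of_mem_picks he).trans ((List.perm_of_mem_picks hf).cons e)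
  have h₁ : Invariant s t n m cap cost val (e' :: f :: R) := by
    simp only [List.mem_cons, List.not_mem_nil, or_false] at he'
    obtain rfl | rfl := he'
    · exact h.perm hp
    · exact (h.perm hp).flip
  have h₂ : Invariant s t n m cap cost val (e' :: f' :: R) := by
    simp only [List.mem_cons, List.not_mem_nil, or_false] at hf'
    obtain rfl | rfl := hf'
    · exact h₁
    · exact ((h₁.perm (.swap _ _ _)).flip).perm (.swap _ _ _)
  obtain ⟨h₃, h₄⟩ := h₂.mergeAt hst hL
  exact ⟨h₃, by rw [h₄, hp.length_eq]; rfl⟩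

/-- A pair of members that can be composed gives a reduction. -/
theorem _root_.reductions_ne_nil {p q : SuperEdge × List SuperEdge} (hp : p ∈ L.picks)
    (hq : q ∈ p.2.picks) (he : e = p.1 ∨ e = p.1.flip) (hf : f = q.1 ∨ f = q.1.flip)
    (hm : _root_.mergeAt s t e f q.2 ≠ []) : reductions s t L ≠ [] := by
  obtain ⟨L', hL'⟩ := List.exists_mem_of_ne_nil _ hm
  refine List.ne_nil_of_mem (a := L') ?_
  simp only [reductions, List.mem_flatMap]
  exact ⟨p, hp, q, hq, e, by simpa using he, f, by simpa using hf, hL'⟩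

theorem _root_.SuperEdge.exists_orientation {e : SuperEdge} {x y : ℕ} (h : s(e.x, e.y) = s(x, y)) :
    ∃ e', (e' = e ∨ e' = e.flip) ∧ e'.x = x ∧ e'.y = y := by
  obtain ⟨rfl, rfl⟩ | ⟨rfl, rfl⟩ := Sym2.eq_iff.1 h
  · exact ⟨e, .inl rfl, rfl, rfl⟩
  · exact ⟨e.flip, .inr rfl, rfl, rfl⟩

theorem _root_.edgeMultiset_of_mem_picks {p : SuperEdge × List SuperEdge} (hp : p ∈ L.picks) :
    edgeMultiset L = s(p.1.x, p.1.y) ::ₘ edgeMultiset p.2 :=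
  Multiset.coe_eq_coe.2 ((List.perm_of_mem_picks hp).map _)

theorem _root_.exists_mem_picks_of_mem {p : Sym2 ℕ} (h : p ∈ edgeMultiset L) :
    ∃ q ∈ L.picks, s(q.1.x, q.1.y) = p := by
  obtain ⟨e, he, rfl⟩ := mem_edgeMultiset.1 h
  obtain ⟨R, hR⟩ := List.exists_mem_picks he
  exact ⟨_, hR, rfl⟩

/-- As long as there is more than one subgraph, a reduction is possible. -/
theorem reductions_ne_nil (h : Invariant s t n m cap cost val L) (hL : 2 ≤ L.length) :
    reductions s t L ≠ [] := by
  obtain ⟨a, b, hS⟩ := h.sp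
  obtain h₁ | ⟨d, hd⟩ | ⟨c, x, y, hxy, -, -, hs⟩ := hS.exists_reduction
  · have := congrArg Multiset.card h₁
    simp only [edgeMultiset, Multiset.coe_card, List.length_map, Multiset.card_singleton] at this
    omega
  · induction d with | _ x y
    obtain ⟨p, hp, hpe⟩ := exists_mem_picks_of_mem (Multiset.count_pos.1
      (show 0 < (edgeMultiset L).count s(x, y) by omega))
    rw [edgeMultiset_of_mem_picks hp, hpe, Multiset.count_cons_self] at hd
    obtain ⟨q, hq, hqe⟩ := exists_mem_picks_of_mem (Multiset.count_pos.1
      (show 0 < (edgeMultiset p.2).count s(x, y) by omega))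
    obtain ⟨e, he, rfl, rfl⟩ := SuperEdge.exists_orientation hpe
    obtain ⟨f, hf, hfx, hfy⟩ := SuperEdge.exists_orientation (hqe.trans Sym2.eq_swap)
    exact _root_.reductions_ne_nil hp hq he hf (by simp [_root_.mergeAt, hfx, hfy])
  · have hx : s(c, x) ∈ SP.star c (edgeMultiset L) := by rw [hs]; simp
    obtain ⟨p, hp, hpe⟩ := exists_mem_picks_of_mem (SP.mem_of_star hx)
    rw [edgeMultiset_of_mem_picks hp, hpe, SP.star, Multiset.filter_cons_of_pos _ (by simp),
      ← SP.star, Multiset.insert_eq_cons, Multiset.cons_inj_right] at hs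
    have hy : s(c, y) ∈ SP.star c (edgeMultiset p.2) := by rw [hs]; simp
    obtain ⟨q, hq, hqe⟩ := exists_mem_picks_of_mem (SP.mem_of_star hy)
    rw [edgeMultiset_of_mem_picks hq, hqe, SP.star, Multiset.filter_cons_of_pos _ (by simp),
      ← SP.star, ← Multiset.cons_zero, Multiset.cons_inj_right] at hs
    obtain ⟨e, he, rfl, rfl⟩ := SuperEdge.exists_orientation (hpe.trans Sym2.eq_swap)
    obtain ⟨f, hf, hfx, rfl⟩ := SuperEdge.exists_orientation hqe
    have hR : (q.2.all fun g => !decide (g.x = e.y) && !decide (g.y = e.y)) = true := by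
      simp only [List.all_eq_true, Bool.and_eq_true, Bool.not_eq_true', decide_eq_false_iff_not]
      intro g hg
      have := Multiset.filter_eq_nil.1 hs s(g.x, g.y) (mem_edgeMultiset.2 ⟨g, hg, rfl⟩)
      simpa [eq_comm] using this
    exact _root_.reductions_ne_nil hp hq he hf (by simp [_root_.mergeAt, hfx, hxy, hR])

theorem reduceStep (h : Invariant s t n m cap cost val L) (hst : s ≠ t) :
    Invariant s t n m cap cost val (reduceStep s t L) ∧
      (_root_.reduceStep s t L).length ≤ max 1 (L.length - 1) := by
  unfold _root_.reduceStep
  cases hr : reductions s t L with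
  | nil =>
    refine ⟨h, ?_⟩
    by_contra hlen
    exact h.reductions_ne_nil (by simp at hlen; omega) hr
  | cons L' _ =>
    obtain ⟨h₁, h₂⟩ := h.of_mem_reductions hst (hr ▸ List.mem_cons_self)
    exact ⟨h₁, by simp; omega⟩

/-- The number of rounds of the reduction is the length of a list `l`. -/
theorem foldl_reduceStep {α : Type*} (l : List α) (h : Invariant s t n m cap cost val L)
    (hst : s ≠ t) :
    Invariant s t n m cap cost val (l.foldl (fun L _ => _root_.reduceStep s t L) L) ∧
      (l.foldl (fun L _ => _root_.reduceStep s t L) L).length ≤ max 1 (L.length - l.length) := by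
  induction l generalizing L with
  | nil => exact ⟨h, by simp⟩
  | cons a l ih =>
    obtain ⟨h₁, h₂⟩ := h.reduceStep hst
    obtain ⟨h₃, h₄⟩ := ih h₁
    exact ⟨h₃, h₄.trans (by rw [List.length_cons]; omega)⟩

end Invariant

/-! ### Sizes of the tables -/

section
variable {k m n : ℕ}

/-- Sums of numbers from the lattice take few values. -/
theorem card_subset_sums_le {K : ℕ} {cap : ℕ → ℤ} {c : ℝ} {d : Fin k → ℝ} {α : ℕ → Fin k → ℤ}
    (hα : ∀ e < m, ∀ i, |α e i| ≤ K) (hcap : ∀ e < m, (cap e : ℝ) = c * ∑ i, (α e i : ℝ) * d i) :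
    ((Finset.range m).powerset.image fun S => ∑ e ∈ S, cap e).card ≤ (2 * (m * K) + 1) ^ k := by
  classical
  let B : Finset (Fin k → ℤ) := Fintype.piFinset fun _ => Finset.Icc (-((m * K : ℕ) : ℤ)) (m * K : ℕ)
  have hB : B.card = (2 * (m * K) + 1) ^ k := by
    rw [Fintype.card_piFinset_const, Int.card_Icc]
    congr 1
    omega
  rw [← hB, ← Finset.card_image_of_injective _ (Int.cast_injective (α := ℝ))]
  refine (Finset.card_le_card ?_).trans
    (Finset.card_image_le (s := B) (f := fun x => c * ∑ i, (x i : ℝ) * d i))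
  intro z hz
  simp only [Finset.mem_image, Finset.mem_powerset] at hz ⊢
  obtain ⟨_, ⟨S, hS, rfl⟩, rfl⟩ := hz
  refine ⟨fun i => ∑ e ∈ S, α e i, Fintype.mem_piFinset.2 fun i => ?_, ?_⟩
  · rw [Finset.mem_Icc, ← abs_le]
    calc |∑ e ∈ S, α e i| ≤ ∑ e ∈ S, |α e i| := Finset.abs_sum_le_sum_abs _ _
      _ ≤ ∑ e ∈ Finset.range m, |α e i| :=
        Finset.sum_le_sum_of_subset_of_nonneg hS fun _ _ _ => abs_nonneg _
      _ ≤ ∑ e ∈ Finset.range m, (K : ℤ) :=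
        Finset.sum_le_sum fun e he => hα e (Finset.mem_range.1 he) i
      _ = (m * K : ℕ) := by simp
  · push_cast
    rw [Finset.sum_congr rfl fun e he => hcap e (Finset.mem_range.1 (hS he)), ← Finset.mul_sum,
      Finset.sum_comm]
    simp only [Finset.sum_mul]

theorem Int.esize_le_of_abs_le {x y : ℤ} (h : |x| ≤ y) : esize x ≤ esize y := by
  have := Nat.size_le_size (show x.natAbs ≤ y.natAbs by rw [abs_le] at h; omega)
  simpa [esize, Enc.enc, Val.size] using this

theorem Nat.esize_le_of_le {x y : ℕ} (h : x ≤ y) : esize x ≤ esize y := by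
  have := Nat.size_le_size h
  simpa [esize, Enc.enc, Val.ofNat, Val.size] using this

theorem Nat.esize_le_succ (x : ℕ) : esize x ≤ x + 1 := by
  have : x.size ≤ x := Nat.size_le.2 Nat.lt_two_pow_self
  simpa [esize, Enc.enc, Val.ofNat, Val.size] using this

namespace SuperEdge.Valid

variable {cap cost : ℕ → ℤ} {e : SuperEdge}

/-- Rows differ in their four capacities, and each of these is a sum of capacities of edges. -/
theorem length_table_le (h : e.Valid cap cost) (hA : e.A ⊆ Finset.range m) :
    e.table.length ≤
      ((Finset.range m).powerset.image fun S => ∑ i ∈ S, cap i).card ^ 4 := by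
  set V := (Finset.range m).powerset.image fun S => ∑ i ∈ S, cap i
  have hc : (Fintype.piFinset fun _ : Bool => Fintype.piFinset fun _ : Bool => V).card =
      V.card ^ 4 := by
    simp only [Fintype.card_piFinset, Finset.prod_const, Finset.card_univ, Fintype.card_bool]
    rw [← pow_mul]
  rw [← hc, ← List.length_map (f := Row.φ), ← List.toFinset_card_of_nodup h.nodup]
  refine Finset.card_le_card fun φ hφ => ?_
  obtain ⟨r, hr, rfl⟩ := List.mem_map.1 (List.mem_toFinset.1 hφ)
  simp only [Fintype.mem_piFinset, V, Finset.mem_image, Finset.mem_powerset]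
  intro a b
  obtain ⟨S, hS, h⟩ := h.sum r.edges.toFinset a b
  exact ⟨S, hS.trans hA, by rw [(‹e.Valid cap cost›.sound r hr).2.2.1, h]⟩

theorem esize_row_le (h : e.Valid cap cost) (hA : e.A ⊆ Finset.range m)
    (hcap : ∀ i, 0 ≤ cap i) (hcost : ∀ i, 0 ≤ cost i) {r : Row} (hr : r ∈ e.table) :
    esize r ≤ 4 * esize (∑ i ∈ Finset.range m, cap i) + esize (∑ i ∈ Finset.range m, cost i) +
      m * (m + 1) + 6 := by
  obtain ⟨h₁, h₂, h₃, h₄⟩ := h.sound r hr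
  have hφ : ∀ a b, esize (r.φ a b) ≤ esize (∑ i ∈ Finset.range m, cap i) := fun a b => by
    obtain ⟨S, hS, hS'⟩ := h.sum r.edges.toFinset a b
    rw [h₃, hS']
    refine Int.esize_le_of_abs_le ?_
    rw [abs_of_nonneg (Finset.sum_nonneg fun i _ => hcap i)]
    exact Finset.sum_le_sum_of_subset_of_nonneg (hS.trans hA) fun i _ _ => hcap i
  have hc : esize r.cost ≤ esize (∑ i ∈ Finset.range m, cost i) := by
    rw [h₄]
    refine Int.esize_le_of_abs_le ?_
    rw [abs_of_nonneg (Finset.sum_nonneg fun i _ => hcost i)]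
    exact Finset.sum_le_sum_of_subset_of_nonneg (h₂.trans hA) fun i _ _ => hcost i
  have hmem : ∀ i ∈ r.edges, i < m := fun i hi =>
    Finset.mem_range.1 (hA (h₂ (List.mem_toFinset.2 hi)))
  have hl : esize r.edges ≤ m * (m + 1) + 1 := by
    refine esize_list_le ?_ fun i hi => (Nat.esize_le_succ i).trans (hmem i hi)
    rw [← List.toFinset_card_of_nodup h₁]
    simpa using Finset.card_le_card (h₂.trans hA)
  have : esize r = esize (r.φ false false) + (esize (r.φ false true) + (esize (r.φ true false) +
      esize (r.φ true true) + 1) + 1) + 1 + (esize r.cost + esize r.edges + 1) + 1 := rfl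
  have := hφ false false
  have := hφ false true
  have := hφ true false
  have := hφ true true
  omega

end SuperEdge.Valid

/-- The size of a list of subgraphs that arises by reductions. -/
theorem Invariant.esize_le {s t : ℕ} {cap cost : ℕ → ℤ} {val : Finset ℕ → (ℕ → Bool) → ℤ}
    {L : List SuperEdge} (h : Invariant s t n m cap cost val L) (hcap : ∀ i, 0 ≤ cap i)
    (hcost : ∀ i, 0 ≤ cost i) (hL : L.length ≤ m) {N : ℕ}
    (hN : ((Finset.range m).powerset.image fun S => ∑ i ∈ S, cap i).card ≤ N) :
    esize L ≤ m * (2 * esize n + (N ^ 4 * (4 * esize (∑ i ∈ Finset.range m, cap i) +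
      esize (∑ i ∈ Finset.range m, cost i) + m * (m + 1) + 6 + 1) + 1) + 3) + 1 := by
  refine esize_list_le (b := 2 * esize n + (N ^ 4 * (4 * esize (∑ i ∈ Finset.range m, cap i) +
      esize (∑ i ∈ Finset.range m, cost i) + m * (m + 1) + 6 + 1) + 1) + 2) hL fun e he => ?_
  have hA : e.A ⊆ Finset.range m := fun i hi => Finset.mem_range.2 ((h.cover i).2 ⟨e, he, hi⟩)
  have hv := h.valid e he
  have h₁ := esize_list_le ((hv.length_table_le hA).trans (Nat.pow_le_pow_left hN 4))
    fun r hr => hv.esize_row_le hA hcap hcost hr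
  have h₂ := Nat.esize_le_of_le (h.lt e he).1.le
  have h₃ := Nat.esize_le_of_le (h.lt e he).2.le
  have : esize e = esize e.x + (esize e.y + esize e.table + 1) + 1 := rfl
  omega

end

/-! ### Instances as data -/

/-- Elements of a subtype are presented like elements of the type. -/
instance {α : Type} [Enc α] {p : α → Prop} : Enc (Subtype p) := ⟨fun x => enc x.1⟩

instance : Enc Instance := ⟨Instance.toVal⟩

/-- An edge as data: the two endpoints, the cost and the capacity. -/
abbrev EdgeData : Type := ℕ × ℕ × (ℕ × ℕ) × (ℕ × ℕ) × Unit

/-- The edges of a network as data. -/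
def Network.edgeData (G : Network) : List EdgeData :=
  List.ofFn fun e => ((G.ends e).1, (G.ends e).2, ((G.cost e).num, (G.cost e).den),
    ((G.cap e).num, (G.cap e).den), ())

/-- The components of an instance: number of vertices, source, sink, edges, and the bound. -/
def Instance.data (I : Instance) : (ℕ × ℕ × ℕ × List EdgeData × Unit) × (ℕ × ℕ) :=
  ((I.net.n, I.net.s, I.net.t, I.net.edgeData, ()), (I.bound.num, I.bound.den))

theorem PolyFun.data {p : Instance → Prop} : PolyFun fun I : Subtype p => I.1.data :=
  .of_enc_eq fun I => by
    change Val.pair _ _ = Val.pair _ _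
    congr 1
    change Val.pair _ (Val.pair _ (Val.pair _ (Val.pair (Val.ofList (List.map _ (List.ofFn _))) _)))
      = Val.ofList [_, _, _, Val.ofList (List.ofFn _)]
    rw [List.map_ofFn]
    rfl

/-- For an element `a` of a list and the list `l` of the others, the fraction `num a / den a`
multiplied by the product of all denominators. -/
def scaleAt {α : Type} (num den : α → ℕ) (p : α × List α) : ℤ :=
  (num p.1 : ℤ) * (p.2.map fun a => (den a : ℤ)).prod

/-- The fractions `num a / den a` for `a` in `L`, multiplied by the product of all denominators. -/
def scaled {α : Type} (num den : α → ℕ) (L : List α) : List ℤ := L.picks.map (scaleAt num den)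

/-- The edges of a network as subgraphs with tables.  Costs and capacities are scaled to become
integers. -/
def initialList (L : List EdgeData) : List SuperEdge :=
  L.picks.zipIdx.map fun q => SuperEdge.single q.2 q.1.1.1 q.1.1.2.1
    (scaleAt (fun e => e.2.2.2.1.1) (fun e => e.2.2.2.1.2) q.1)
    (scaleAt (fun e => e.2.2.1.1) (fun e => e.2.2.1.2) q.1)

/-- A row of `T` at which `f` is maximum. -/
def bestRow (f : Row → ℤ) (T : List Row) : Row :=
  T.foldl (fun a r => bif decide (f a ≤ f r) then r else a) (T.headD ⟨fun _ _ => 0, 0, []⟩)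

namespace PolyFun
section
variable {α β : Type} [Enc α] [Enc β]

@[fun_prop]
theorem scaleAt {num den : β → ℕ} {p : α → β × List β} (hn : PolyFun num) (hd : PolyFun den)
    (hp : PolyFun p) : PolyFun fun x => scaleAt num den (p x) := by
  unfold _root_.scaleAt
  fun_prop

@[fun_prop]
theorem scaled {num den : β → ℕ} {L : α → List β} (hn : PolyFun num) (hd : PolyFun den)
    (hL : PolyFun L) : PolyFun fun x => scaled num den (L x) := by
  unfold _root_.scaled
  exact list_map (f := fun _ p => _root_.scaleAt num den p) (by fun_prop) (by fun_prop)

@[fun_prop]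
theorem initialList {L : α → List EdgeData} (hL : PolyFun L) :
    PolyFun fun x => initialList (L x) := by
  unfold _root_.initialList
  fun_prop

@[fun_prop]
theorem list_sum {l : α → List ℤ} (hl : PolyFun l) : PolyFun fun x => (l x).sum := by
  have : PolyFun fun x => (l x).foldl (fun a b => a + b) 0 :=
    foldl_of_growth (s := fun _ a b => a + b) (B := fun p => esize p.2) hl (const 0)
      (by fun_prop) (PolyBdd.esize_comp (by fun_prop)) fun x b c => Int.esize_add_le b c
  exact this.congr_enc fun x => by rw [← List.sum_eq_foldl]

theorem bestRow {f : α → Row → ℤ} {T : α → List Row} (hf : PolyFun fun p : α × Row => f p.1 p.2)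
    (hT : PolyFun T) : PolyFun fun x => bestRow (f x) (T x) := by
  unfold _root_.bestRow
  refine foldl_of_growth (s := fun x a r => bif decide (f x a ≤ f x r) then r else a)
    (B := fun p => esize p.2) hT (by fun_prop) ?_ (PolyBdd.esize_comp (by fun_prop))
    fun x a r => ?_
  · have h₁ := hf.comp (f := fun p : α × Row × Row => (p.1, p.2.1)) (by fun_prop)
    have h₂ := hf.comp (f := fun p : α × Row × Row => (p.1, p.2.2)) (by fun_prop)
    dsimp only at h₁ h₂
    fun_prop
  · cases decide (f x a ≤ f x r) <;> simp

end
end PolyFun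

theorem bestRow_mem {f : Row → ℤ} {T : List Row} (h : T ≠ []) :
    bestRow f T ∈ T ∧ ∀ r ∈ T, f r ≤ f (bestRow f T) := by
  have key : ∀ (L : List Row) (a : Row),
      (L.foldl (fun a r => bif decide (f a ≤ f r) then r else a) a ∈ a :: L) ∧ ∀ r ∈ a :: L,
        f r ≤ f (L.foldl (fun a r => bif decide (f a ≤ f r) then r else a) a) := by
    intro L
    induction L with
    | nil => exact fun a => ⟨List.mem_singleton_self a, fun r hr => by rw [List.mem_singleton.1 hr]; rfl⟩
    | cons b L ih =>
      intro a
      rw [List.foldl_cons]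
      by_cases hab : f a ≤ f b
      · obtain ⟨h₁, h₂⟩ := ih b
        rw [decide_eq_true hab, cond_true]
        refine ⟨List.mem_cons_of_mem _ h₁, ?_⟩
        simp only [List.forall_mem_cons] at h₂ ⊢
        exact ⟨hab.trans h₂.1, h₂⟩
      · obtain ⟨h₁, h₂⟩ := ih a
        rw [decide_eq_false hab, cond_false]
        refine ⟨?_, ?_⟩
        · obtain h | h := List.mem_cons.1 h₁
          · rw [h]; exact List.mem_cons_self
          · exact List.mem_cons_of_mem _ (List.mem_cons_of_mem _ h)
        · simp only [List.forall_mem_cons] at h₂ ⊢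
          exact ⟨h₂.1, (not_le.1 hab).le.trans h₂.1, h₂.2⟩
  obtain ⟨a, L, rfl⟩ := List.exists_cons_of_ne_nil h
  have ⟨h₁, h₂⟩ := key (a :: L) a
  refine ⟨?_, fun r hr => h₂ r (List.mem_cons_of_mem _ hr)⟩
  simpa [bestRow] using h₁

theorem List.getElem_picks {α : Type*} (l : List α) (i : ℕ) (hi : i < l.picks.length) :
    l.picks[i] = (l[i]'(by simpa using hi), l.eraseIdx i) := by
  induction l generalizing i with
  | nil => simp [List.picks] at hi
  | cons a l ih =>
    cases i with
    | zero => rfl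
    | succ i => simp [List.picks, ih]

theorem scaleAt_of_mem_picks {α : Type} {num den : α → ℕ} {L : List α} {p : α × List α}
    (hp : p ∈ L.picks) (h : den p.1 ≠ 0) :
    (scaleAt num den p : ℝ) =
      num p.1 / den p.1 * ((L.map fun a => (den a : ℤ)).prod : ℤ) := by
  have h' : (den p.1 : ℝ) ≠ 0 := by exact_mod_cast h
  rw [((List.perm_of_mem_picks hp).map fun a => (den a : ℤ)).prod_eq, List.map_cons,
    List.prod_cons, scaleAt]
  push_cast
  field_simp

namespace Network

variable (G : Network)

/-- The common denominator of the capacities. -/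
def capDenom : ℤ := (G.edgeData.map fun e => (e.2.2.2.1.2 : ℤ)).prod

/-- The common denominator of the costs. -/
def costDenom : ℤ := (G.edgeData.map fun e => (e.2.2.1.2 : ℤ)).prod

/-- The scaled capacities. -/
def scaledCap (i : ℕ) : ℤ :=
  (scaled (fun e => e.2.2.2.1.1) (fun e => e.2.2.2.1.2) G.edgeData).getD i 0

/-- The scaled costs. -/
def scaledCost (i : ℕ) : ℤ :=
  (scaled (fun e => e.2.2.1.1) (fun e => e.2.2.1.2) G.edgeData).getD i 0

@[simp]
theorem length_edgeData : G.edgeData.length = G.m := by simp [edgeData]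

theorem getElem_edgeData (e : Fin G.m) : G.edgeData[(e : ℕ)]'(by simp) =
    (((G.ends e).1 : ℕ), ((G.ends e).2 : ℕ), ((G.cost e).num, (G.cost e).den),
    ((G.cap e).num, (G.cap e).den), ()) := by simp [edgeData]

theorem capDenom_pos : 0 < G.capDenom := by
  refine List.prod_pos fun z hz => ?_
  obtain ⟨e, he, rfl⟩ := List.mem_map.1 hz
  obtain ⟨i, rfl⟩ := (List.mem_ofFn' _ _).1 he
  exact_mod_cast (G.cap i).den_pos

theorem costDenom_pos : 0 < G.costDenom := by
  refine List.prod_pos fun z hz => ?_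
  obtain ⟨e, he, rfl⟩ := List.mem_map.1 hz
  obtain ⟨i, rfl⟩ := (List.mem_ofFn' _ _).1 he
  exact_mod_cast (G.cost i).den_pos

theorem scaledCap_eq (e : Fin G.m) : (G.scaledCap e : ℝ) = G.cap e * G.capDenom := by
  have he : (e : ℕ) < G.edgeData.picks.length := by simp
  have h := scaleAt_of_mem_picks (num := fun e : EdgeData => e.2.2.2.1.1)
    (den := fun e => e.2.2.2.1.2) (List.getElem_mem he)
    (by rw [List.getElem_picks, getElem_edgeData]; exact (G.cap e).den_ne_zero)
  rw [scaledCap, scaled, List.getD_eq_getElem _ _ (by simp), List.getElem_map, h,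
    List.getElem_picks, getElem_edgeData, NNRat.cast_def (G.cap e)]
  rfl

theorem scaledCost_eq (e : Fin G.m) : (G.scaledCost e : ℝ) = G.cost e * G.costDenom := by
  have he : (e : ℕ) < G.edgeData.picks.length := by simp
  have h := scaleAt_of_mem_picks (num := fun e : EdgeData => e.2.2.1.1)
    (den := fun e => e.2.2.1.2) (List.getElem_mem he)
    (by rw [List.getElem_picks, getElem_edgeData]; exact (G.cost e).den_ne_zero)
  rw [scaledCost, scaled, List.getD_eq_getElem _ _ (by simp), List.getElem_map, h,
    List.getElem_picks, getElem_edgeData, NNRat.cast_def (G.cost e)]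
  rfl

theorem scaledCap_nonneg (i : ℕ) : 0 ≤ G.scaledCap i := by
  by_cases hi : i < G.m
  · have := G.scaledCap_eq ⟨i, hi⟩
    have h₁ : (0 : ℝ) ≤ G.cap ⟨i, hi⟩ * G.capDenom :=
      mul_nonneg (NNRat.cast_nonneg _) (by exact_mod_cast G.capDenom_pos.le)
    rw [← this] at h₁
    exact_mod_cast h₁
  · rw [scaledCap, List.getD_eq_default _ _ (by simpa [scaled] using hi)]

theorem scaledCost_nonneg (i : ℕ) : 0 ≤ G.scaledCost i := by
  by_cases hi : i < G.m
  · have := G.scaledCost_eq ⟨i, hi⟩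
    have h₁ : (0 : ℝ) ≤ G.cost ⟨i, hi⟩ * G.costDenom :=
      mul_nonneg (NNRat.cast_nonneg _) (by exact_mod_cast G.costDenom_pos.le)
    rw [← this] at h₁
    exact_mod_cast h₁
  · rw [scaledCost, List.getD_eq_default _ _ (by simpa [scaled] using hi)]

theorem initialList_eq : initialList G.edgeData = List.ofFn fun e : Fin G.m =>
    SuperEdge.single e (G.ends e).1 (G.ends e).2 (G.scaledCap e) (G.scaledCost e) := by
  refine List.ext_getElem (by simp [initialList]) fun i h₁ h₂ => ?_
  have hi : i < G.m := by simpa using h₂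
  rw [List.getElem_ofFn, scaledCap, scaledCost, scaled, scaled,
    List.getD_eq_getElem _ _ (by simpa using hi), List.getD_eq_getElem _ _ (by simpa using hi)]
  simp only [initialList, List.getElem_map, List.getElem_zipIdx, List.getElem_picks,
    G.getElem_edgeData ⟨i, hi⟩, zero_add]

/-- The edges of a series-parallel part of a network form a series-parallel multigraph on the
natural numbers, all of whose vertices lie in the vertex set of the part. -/
theorem SPOn.toSP {G : Network} {W : Finset (Fin G.n)} {F : Finset (Fin G.m)} {a b : Fin G.n}
    (h : G.SPOn W F a b) :
    SP (F.val.map fun e => s(((G.ends e).1 : ℕ), ((G.ends e).2 : ℕ))) (a : ℕ) b ∧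
      ∀ x : ℕ, (∃ p ∈ F.val.map fun e => s(((G.ends e).1 : ℕ), ((G.ends e).2 : ℕ)), x ∈ p) →
        ∃ v ∈ W, (v : ℕ) = x := by
  induction h with
  | edge e a b hab h =>
    have he : s(((G.ends e).1 : ℕ), ((G.ends e).2 : ℕ)) = s((a : ℕ), (b : ℕ)) := by
      obtain h | h := h <;> simp [h, Sym2.eq_swap]
    simp only [Finset.singleton_val, Multiset.map_singleton, he]
    refine ⟨.edge fun h => hab (Fin.ext h), fun x hx => ?_⟩
    simpa [eq_comm] using hx
  | @series W₁ W₂ F₁ F₂ a c b h₁ h₂ hW hF ih₁ ih₂ =>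
    rw [← Finset.disjUnion_eq_union _ _ hF, Finset.disjUnion_val, Multiset.map_add]
    refine ⟨.series ih₁.1 ih₂.1 fun x hx hx' => ?_, fun x hx => ?_⟩
    · obtain ⟨v, hv, rfl⟩ := ih₁.2 x hx
      obtain ⟨w, hw, hwv⟩ := ih₂.2 _ hx'
      obtain rfl := Fin.ext hwv
      have : w ∈ W₁ ∩ W₂ := Finset.mem_inter.2 ⟨hv, hw⟩
      rw [hW, Finset.mem_singleton] at this
      rw [this]
    · obtain hx | hx := SP.mem_add_iff.1 hx
      · exact (ih₁.2 x hx).imp fun v hv => ⟨Finset.mem_union_left _ hv.1, hv.2⟩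
      · exact (ih₂.2 x hx).imp fun v hv => ⟨Finset.mem_union_right _ hv.1, hv.2⟩
  | @parallel W₁ W₂ F₁ F₂ a b h₁ h₂ hW hF ih₁ ih₂ =>
    rw [← Finset.disjUnion_eq_union _ _ hF, Finset.disjUnion_val, Multiset.map_add]
    refine ⟨.parallel ih₁.1 ih₂.1 fun x hx hx' => ?_, fun x hx => ?_⟩
    · obtain ⟨v, hv, rfl⟩ := ih₁.2 x hx
      obtain ⟨w, hw, hwv⟩ := ih₂.2 _ hx'
      obtain rfl := Fin.ext hwv
      have : w ∈ W₁ ∩ W₂ := Finset.mem_inter.2 ⟨hv, hw⟩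
      rw [hW, Finset.mem_insert, Finset.mem_singleton] at this
      exact this.imp (congrArg _) (congrArg _)
    · obtain hx | hx := SP.mem_add_iff.1 hx
      · exact (ih₁.2 x hx).imp fun v hv => ⟨Finset.mem_union_left _ hv.1, hv.2⟩
      · exact (ih₂.2 x hx).imp fun v hv => ⟨Finset.mem_union_right _ hv.1, hv.2⟩

theorem invariant_initialList {G : Network} (h : G.IsSeriesParallel) :
    Invariant G.s G.t G.n G.m G.scaledCap G.scaledCost
      (fun F σ => cutSum F σ (initialList G.edgeData)) (initialList G.edgeData) where
  valid e he := by
    rw [initialList_eq, List.mem_ofFn'] at he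
    obtain ⟨i, rfl⟩ := he
    exact .single _ _ _ (G.scaledCost_nonneg i)
  disjoint := by
    rw [initialList_eq, List.pairwise_ofFn]
    intro i j hij
    simpa [SuperEdge.single] using fun h => hij.ne (Fin.ext h)
  cover i := by
    simp only [initialList_eq, List.mem_ofFn', Set.mem_range, exists_exists_eq_and,
      SuperEdge.single, Finset.mem_singleton]
    exact ⟨fun h => ⟨⟨i, h⟩, rfl⟩, fun ⟨j, hj⟩ => hj ▸ j.2⟩
  lt e he := by
    rw [initialList_eq, List.mem_ofFn'] at he
    obtain ⟨i, rfl⟩ := he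
    exact ⟨(G.ends i).1.2, (G.ends i).2.2⟩
  sp := by
    obtain ⟨a, b, hab⟩ := h
    refine ⟨a, b, ?_⟩
    rw [edgeMultiset, initialList_eq, List.map_ofFn, ← Fin.univ_val_map]
    exact hab.toSP.1
  le F σ hσ := ⟨σ, hσ, le_rfl⟩
  ge F σ hσ := ⟨σ, hσ, le_rfl⟩

/-- The capacities of cuts, scaled. -/
theorem cutSum_initialList (F : Finset (Fin G.m)) (σ : ℕ → Bool) :
    (cutSum (F.map Fin.valEmbedding) σ (initialList G.edgeData) : ℝ) =
      G.cutCap F (fun v => σ v) * G.capDenom := by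
  rw [cutSum, initialList_eq, List.map_ofFn, List.sum_ofFn, cutCap, NNRat.cast_sum,
    Finset.sum_mul, Int.cast_sum, ← Finset.sum_subset (Finset.subset_univ F)]
  · refine Finset.sum_congr rfl fun e he => ?_
    by_cases h : σ (G.ends e).1 = σ (G.ends e).2
    · simp [SuperEdge.single, h]
    · have he' : (e : ℕ) ∈ F.map Fin.valEmbedding := Finset.mem_map_of_mem _ he
      simp [SuperEdge.single, h, -Finset.mem_map, he', beq_false_of_ne h, scaledCap_eq]
  · intro e _ he
    simp [SuperEdge.single, he, Fin.val_inj]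

theorem sum_scaledCost_map (F : Finset (Fin G.m)) :
    ((∑ i ∈ F.map Fin.valEmbedding, G.scaledCost i : ℤ) : ℝ) = G.setCost F * G.costDenom := by
  rw [Finset.sum_map, setCost, NNRat.cast_sum, Finset.sum_mul, Int.cast_sum]
  exact Finset.sum_congr rfl fun e _ => G.scaledCost_eq e

end Network

/-! ### The two algorithms -/

namespace Instance

/-- The result of the reductions; on series-parallel instances it has exactly one member. -/
def reduced (I : Instance) : List SuperEdge :=
  (initialList I.net.edgeData).foldl (fun L _ => reduceStep I.net.s I.net.t L)
    (initialList I.net.edgeData)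

/-- The subgraph that remains after all reductions; it is the whole network. -/
def root (I : Instance) : SuperEdge := I.reduced.headD (SuperEdge.single 0 0 0 0 0)

/-- The scaled maximum value of a flow in the set of edges that `r` describes. -/
def flowValue (I : Instance) (r : Row) : ℤ :=
  minSide I.net.s I.net.t I.root.x fun a => minSide I.net.s I.net.t I.root.y fun b => r.φ a b

/-- The rows that respect the budget. -/
def affordable (I : Instance) : List Row :=
  I.root.table.filter fun r => decide (r.cost * I.bound.den ≤ I.bound.num * I.net.costDenom)

/-- The rows that meet the demand. -/
def sufficient (I : Instance) : List Row :=
  I.root.table.filter fun r => decide (I.bound.num * I.net.capDenom ≤ I.flowValue r * I.bound.den)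

/-- The algorithm for BCMFP. -/
def solveBCMFP (I : Instance) : List ℕ := (bestRow I.flowValue I.affordable).edges

/-- The algorithm for CapNDP. -/
def solveCapNDP (I : Instance) : Option (List ℕ) :=
  bif I.sufficient.isEmpty then none
  else some (bestRow (fun r => -1 * r.cost) I.sufficient).edges

end Instance

namespace PolyFun

section
variable {p : Instance → Prop}

theorem source : PolyFun fun I : Subtype p => (I.1.net.s : ℕ) :=
  (data (p := p)).fst.snd.fst

theorem sink : PolyFun fun I : Subtype p => (I.1.net.t : ℕ) :=
  (data (p := p)).fst.snd.snd.fst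

theorem card_vertices : PolyFun fun I : Subtype p => I.1.net.n :=
  (data (p := p)).fst.fst

theorem edgeData : PolyFun fun I : Subtype p => I.1.net.edgeData :=
  (data (p := p)).fst.snd.snd.snd.fst

theorem bound_num : PolyFun fun I : Subtype p => I.1.bound.num :=
  (data (p := p)).snd.fst

theorem bound_den : PolyFun fun I : Subtype p => I.1.bound.den :=
  (data (p := p)).snd.snd

theorem capDenom : PolyFun fun I : Subtype p => I.1.net.capDenom :=
  comp (g := fun L : List EdgeData => (L.map fun e => (e.2.2.2.1.2 : ℤ)).prod) (by fun_prop)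
    edgeData

theorem costDenom : PolyFun fun I : Subtype p => I.1.net.costDenom :=
  comp (g := fun L : List EdgeData => (L.map fun e => (e.2.2.1.2 : ℤ)).prod) (by fun_prop)
    edgeData

end

@[fun_prop]
theorem option_some {α β : Type} [Enc α] [Enc β] {f : α → β} (hf : PolyFun f) :
    PolyFun fun x => some (f x) :=
  ((const (1 : ℤ)).prodMk hf).congr_enc fun _ => rfl

end PolyFun

theorem List.sum_range_getD (l : List ℤ) : ∑ i ∈ Finset.range l.length, l.getD i 0 = l.sum := by
  induction l with
  | nil => simp
  | cons a l ih => simp [Finset.sum_range_succ', ← ih, add_comm]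

theorem Network.sum_scaledCap (G : Network) : ∑ i ∈ Finset.range G.m, G.scaledCap i =
    (scaled (fun e => e.2.2.2.1.1) (fun e => e.2.2.2.1.2) G.edgeData).sum := by
  rw [← List.sum_range_getD]
  simp [scaled, scaledCap]

theorem Network.sum_scaledCost (G : Network) : ∑ i ∈ Finset.range G.m, G.scaledCost i =
    (scaled (fun e => e.2.2.1.1) (fun e => e.2.2.1.2) G.edgeData).sum := by
  rw [← List.sum_range_getD]
  simp [scaled, scaledCost]

section
variable {k : ℕ} {p : Polynomial ℕ}

theorem polyBdd_card_edges {C : Instance → Prop} : PolyBdd fun I : Subtype C => I.1.net.m :=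
  (PolyBdd.esize_comp PolyFun.edgeData).mono fun I => by
    have := length_lt_esize I.1.net.edgeData
    rw [Network.length_edgeData] at this
    exact this.le

/-- This is where the restriction on the capacities is used: it bounds the number of values that the
entries of a table can take. -/
theorem card_scaledCap_sums_le (I : latticeInstances k p) :
    ((Finset.range I.1.net.m).powerset.image fun S => ∑ i ∈ S, I.1.net.scaledCap i).card ≤
      (2 * (I.1.net.m * p.eval (esize I)) + 1) ^ k := by
  obtain ⟨K, hK, d, hd⟩ := I.2.2
  choose α hα hcap using hd
  have h := card_subset_sums_le (m := I.1.net.m) (K := K) (cap := I.1.net.scaledCap)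
    (c := I.1.net.capDenom) (d := d)
    (α := fun e i => if h : e < I.1.net.m then α ⟨e, h⟩ i else 0)
    (fun e he i => by simpa [he] using hα ⟨e, he⟩ i)
    (fun e he => by
      have := I.1.net.scaledCap_eq ⟨e, he⟩
      simp only [he, dite_true]
      rw [this, hcap, mul_comm])
  refine h.trans (Nat.pow_le_pow_left ?_ k)
  have := Nat.mul_le_mul_left I.1.net.m hK
  change I.1.net.m * K ≤ I.1.net.m * p.eval (esize I) at this
  omega

namespace Instance

variable {I : Instance}

/-- The invariant holds after any number of reduction steps, here the length of `l`. -/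
theorem invariant_foldl (h : I.net.IsSeriesParallel) (l : List SuperEdge) :
    Invariant I.net.s I.net.t I.net.n I.net.m I.net.scaledCap I.net.scaledCost
      (fun F σ => cutSum F σ (initialList I.net.edgeData))
      (l.foldl (fun L _ => reduceStep I.net.s I.net.t L) (initialList I.net.edgeData)) ∧
    (l.foldl (fun L _ => reduceStep I.net.s I.net.t L) (initialList I.net.edgeData)).length ≤
      max 1 (I.net.m - l.length) := by
  have hst : (I.net.s : ℕ) ≠ I.net.t := fun h => I.net.s_ne_t (Fin.ext h)
  have := (Network.invariant_initialList h).foldl_reduceStep l hst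
  rwa [show (initialList I.net.edgeData).length = I.net.m by simp [initialList]] at this

theorem card_edges_pos (h : I.net.IsSeriesParallel) : 0 < I.net.m := by
  obtain ⟨a, b, hab⟩ := h
  obtain ⟨⟨e, he, -⟩, -⟩ := hab.toSP.1.terminals
  obtain ⟨i, -, -⟩ := Multiset.mem_map.1 he
  exact i.pos

theorem reduced_eq (h : I.net.IsSeriesParallel) : I.reduced = [I.root] := by
  obtain ⟨h₁, h₂⟩ := invariant_foldl h (initialList I.net.edgeData)
  rw [show (initialList I.net.edgeData).length = I.net.m by simp [initialList], Nat.sub_self,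
    max_eq_left (by norm_num)] at h₂
  obtain ⟨a, b, hab⟩ := h₁.sp
  obtain ⟨⟨e, he, -⟩, -⟩ := hab.terminals
  obtain ⟨f, hf, -⟩ := mem_edgeMultiset.1 he
  have h₃ := List.length_pos_of_mem hf
  obtain ⟨g, hg⟩ := List.length_eq_one_iff.1 (le_antisymm h₂ h₃)
  rw [root, reduced, hg]
  rfl

theorem invariant_root (h : I.net.IsSeriesParallel) :
    Invariant I.net.s I.net.t I.net.n I.net.m I.net.scaledCap I.net.scaledCost
      (fun F σ => cutSum F σ (initialList I.net.edgeData)) [I.root] := by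
  rw [← reduced_eq h]
  exact (invariant_foldl h _).1

theorem root_A (h : I.net.IsSeriesParallel) : I.root.A = Finset.range I.net.m := by
  ext i
  rw [Finset.mem_range, (invariant_root h).cover]
  simp

/-- Max-flow min-cut and the invariant: the value read off a row is the scaled maximum flow. -/
theorem flowValue_eq (h : I.net.IsSeriesParallel) {r : Row} {F : Finset (Fin I.net.m)}
    (hr : r.φ = I.root.ψ (F.map Fin.valEmbedding)) :
    (I.flowValue r : ℝ) = I.net.maxFlow F * I.net.capDenom := by
  have hst : (I.net.s : ℕ) ≠ I.net.t := fun h => I.net.s_ne_t (Fin.ext h)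
  have hinv := invariant_root h
  have hD : (0 : ℝ) ≤ I.net.capDenom := by exact_mod_cast I.net.capDenom_pos.le
  have hxy : I.root.x ≠ I.root.y := by
    obtain ⟨a, b, hab⟩ := hinv.sp
    simpa using hab.not_isDiag s(I.root.x, I.root.y) (by simp [edgeMultiset_cons])
  refine le_antisymm ?_ ?_
  · obtain ⟨σ, hs, ht, hσ⟩ := I.net.exists_maxFlow_eq_cutCap F
    obtain ⟨σ', hσ', hle⟩ := hinv.le (F.map Fin.valEmbedding)
      (fun v => if h : v < I.net.n then σ ⟨v, h⟩ else false) ⟨by simpa using hs, by simpa using ht⟩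
    have hle' : (cutSum (F.map Fin.valEmbedding) σ' [I.root] : ℝ) ≤
        I.net.maxFlow F * I.net.capDenom := by
      rw [hσ]
      refine (Int.cast_le.2 hle).trans_eq ?_
      rw [I.net.cutSum_initialList]
      simp
    refine le_trans ?_ hle'
    rw [Int.cast_le, cutSum_cons, ← hr, show cutSum (F.map Fin.valEmbedding) σ' [] = 0 from rfl,
      add_zero]
    refine (minSide_le (z := σ' I.root.x) ?_ ?_).trans (minSide_le (z := σ' I.root.y) ?_ ?_)
    all_goals intro h; rw [h]
    exacts [hσ'.1, hσ'.2, hσ'.1, hσ'.2]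
  · obtain ⟨z, hz₁, hz₂, hz⟩ := exists_minSide_eq hst I.root.x fun a =>
      minSide I.net.s I.net.t I.root.y fun b => r.φ a b
    obtain ⟨w, hw₁, hw₂, hw⟩ := exists_minSide_eq hst I.root.y fun b => r.φ z b
    let σ : ℕ → Bool := fun v =>
      if v = I.root.x then z else if v = I.root.y then w else decide (v = I.net.s)
    have hσ : Admissible I.net.s I.net.t σ := by
      constructor
      · by_cases h₁ : (I.net.s : ℕ) = I.root.x
        · simpa [σ, h₁] using hz₁ h₁.symm
        by_cases h₂ : (I.net.s : ℕ) = I.root.y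
        · simpa [σ, h₁, h₂, hxy.symm] using hw₁ h₂.symm
        · simp [σ, h₁, h₂]
      · by_cases h₁ : (I.net.t : ℕ) = I.root.x
        · simpa [σ, h₁] using hz₂ h₁.symm
        by_cases h₂ : (I.net.t : ℕ) = I.root.y
        · simpa [σ, h₁, h₂, hxy.symm] using hw₂ h₂.symm
        · simpa [σ, h₁, h₂] using hst.symm
    obtain ⟨σ', hσ', hge⟩ := hinv.ge (F.map Fin.valEmbedding) σ hσ
    have h₁ : cutSum (F.map Fin.valEmbedding) σ [I.root] = I.flowValue r := by
      rw [flowValue, hz, hw, cutSum_cons, ← hr,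
        show cutSum (F.map Fin.valEmbedding) σ [] = 0 from rfl, add_zero]
      simp [σ, hxy.symm]
    rw [h₁] at hge
    refine le_trans ?_ (Int.cast_le.2 hge)
    rw [I.net.cutSum_initialList]
    exact mul_le_mul_of_nonneg_right (Network.maxFlow_le_cutCap hσ'.1 hσ'.2) hD

/-- Every row of the final table describes a set of edges. -/
theorem exists_edges_of_mem (h : I.net.IsSeriesParallel) {r : Row} (hr : r ∈ I.root.table) :
    ∃ F, I.net.RepresentsEdges (enc r.edges) F ∧
      (I.flowValue r : ℝ) = I.net.maxFlow F * I.net.capDenom ∧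
      (r.cost : ℝ) = I.net.setCost F * I.net.costDenom := by
  obtain ⟨h₁, h₂, h₃, h₄⟩ := ((invariant_root h).valid I.root (by simp)).sound r hr
  rw [root_A h] at h₂
  obtain ⟨l, hl⟩ : ∃ l : List (Fin I.net.m), l.map Fin.val = r.edges := by
    have : ∀ i ∈ r.edges, i < I.net.m := fun i hi =>
      Finset.mem_range.1 (h₂ (List.mem_toFinset.2 hi))
    exact ⟨r.edges.pmap Fin.mk this, by simp [List.map_pmap]⟩
  have hF : r.edges.toFinset = l.toFinset.map Fin.valEmbedding := by
    rw [← hl]; ext i; simp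
  refine ⟨l.toFinset, ⟨l, ?_, rfl, ?_⟩, flowValue_eq h (by rw [h₃, hF]), ?_⟩
  · rw [← hl] at h₁
    exact h₁.of_map _
  · change Val.ofList (r.edges.map enc) = _
    rw [← hl]
    simp only [bind_pure_comp, List.map_eq_map]
    rfl
  · rw [h₄, hF, Network.sum_scaledCost_map]

/-- Every set of edges is dominated by a row of the final table. -/
theorem exists_mem_of_edges (h : I.net.IsSeriesParallel) (F : Finset (Fin I.net.m)) :
    ∃ r ∈ I.root.table, (I.flowValue r : ℝ) = I.net.maxFlow F * I.net.capDenom ∧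
      (r.cost : ℝ) ≤ I.net.setCost F * I.net.costDenom := by
  obtain ⟨r, hr, hφ, hc⟩ := ((invariant_root h).valid I.root (by simp)).complete
    (F.map Fin.valEmbedding) (by
      rw [root_A h]
      intro i hi
      obtain ⟨j, -, rfl⟩ := Finset.mem_map.1 hi
      exact Finset.mem_range.2 j.2)
  refine ⟨r, hr, flowValue_eq h hφ, ?_⟩
  rw [← Network.sum_scaledCost_map]
  exact_mod_cast hc

theorem bound_cast : (I.bound : ℝ) * I.bound.den = I.bound.num := by
  rw [NNRat.cast_def, div_mul_cancel₀]
  exact_mod_cast I.bound.den_ne_zero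

theorem mem_affordable {r : Row} : r ∈ I.affordable ↔
    r ∈ I.root.table ∧ (r.cost : ℝ) ≤ I.bound * I.net.costDenom := by
  have hden : (0 : ℝ) < I.bound.den := by exact_mod_cast I.bound.den_pos
  rw [affordable, List.mem_filter, decide_eq_true_eq, ← mul_le_mul_iff_left₀ hden,
    mul_right_comm, bound_cast]
  norm_cast

theorem mem_sufficient {r : Row} : r ∈ I.sufficient ↔
    r ∈ I.root.table ∧ (I.bound : ℝ) * I.net.capDenom ≤ I.flowValue r := by
  have hden : (0 : ℝ) < I.bound.den := by exact_mod_cast I.bound.den_pos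
  rw [sufficient, List.mem_filter, decide_eq_true_eq, ← mul_le_mul_iff_left₀ hden,
    mul_right_comm, bound_cast]
  norm_cast

theorem solveBCMFP_correct (h : I.net.IsSeriesParallel) :
    BCMFPAnswer I (enc I.solveBCMFP) := by
  have hD : (0 : ℝ) < I.net.capDenom := by exact_mod_cast I.net.capDenom_pos
  have hC : (0 : ℝ) < I.net.costDenom := by exact_mod_cast I.net.costDenom_pos
  have hrow : ∀ F, I.net.setCost F ≤ I.bound →
      ∃ r ∈ I.affordable, (I.flowValue r : ℝ) = I.net.maxFlow F * I.net.capDenom := by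
    intro F hF
    obtain ⟨r, hr, hv, hc⟩ := exists_mem_of_edges h F
    refine ⟨r, mem_affordable.2 ⟨hr, hc.trans ?_⟩, hv⟩
    exact mul_le_mul_of_nonneg_right (NNRat.cast_le.2 hF) hC.le
  obtain ⟨r₀, hr₀, -⟩ := hrow ∅ (by simp [Network.setCost])
  obtain ⟨h₁, h₂⟩ := bestRow_mem (f := I.flowValue) (List.ne_nil_of_mem hr₀)
  obtain ⟨h₃, h₄⟩ := mem_affordable.1 h₁
  obtain ⟨F, hF, hv, hc⟩ := exists_edges_of_mem h h₃
  refine ⟨F, hF, ?_, fun F' hF' => ?_⟩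
  · rw [hc, mul_le_mul_iff_left₀ hC] at h₄
    exact NNRat.cast_le.1 h₄
  · obtain ⟨r, hr, hv'⟩ := hrow F' hF'
    have := Int.cast_le (R := ℝ).2 (h₂ r hr)
    rwa [hv', hv, mul_le_mul_iff_left₀ hD] at this

theorem solveCapNDP_correct (h : I.net.IsSeriesParallel) :
    CapNDPAnswer I (enc I.solveCapNDP) := by
  have hD : (0 : ℝ) < I.net.capDenom := by exact_mod_cast I.net.capDenom_pos
  have hC : (0 : ℝ) < I.net.costDenom := by exact_mod_cast I.net.costDenom_pos
  have hrow : ∀ F, IsCapNDPFeasible I F →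
      ∃ r ∈ I.sufficient, (r.cost : ℝ) ≤ I.net.setCost F * I.net.costDenom := by
    intro F hF
    obtain ⟨r, hr, hv, hc⟩ := exists_mem_of_edges h F
    refine ⟨r, mem_sufficient.2 ⟨hr, ?_⟩, hc⟩
    rw [hv]
    exact mul_le_mul_of_nonneg_right hF hD.le
  unfold solveCapNDP
  by_cases hT : I.sufficient = []
  · rw [hT]
    refine .inr ⟨rfl, fun F hF => ?_⟩
    obtain ⟨r, hr, -⟩ := hrow F hF
    simp [hT] at hr
  · obtain ⟨h₁, h₂⟩ := bestRow_mem (f := fun r => -1 * r.cost) hT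
    obtain ⟨h₃, h₄⟩ := mem_sufficient.1 h₁
    obtain ⟨F, hF, hv, hc⟩ := exists_edges_of_mem h h₃
    rw [List.isEmpty_eq_false_iff.2 hT, cond_false]
    refine .inl ⟨_, F, rfl, hF, ?_, fun F' hF' => ?_⟩
    · rwa [hv, mul_le_mul_iff_left₀ hD] at h₄
    · obtain ⟨r, hr, hc'⟩ := hrow F' hF'
      have h₅ : (bestRow (fun r => -1 * r.cost) I.sufficient).cost ≤ r.cost := by
        have := h₂ r hr
        linarith
      have h₆ := (Int.cast_le (R := ℝ).2 h₅).trans hc'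
      rw [hc, mul_le_mul_iff_left₀ hC] at h₆
      exact NNRat.cast_le.1 h₆

end Instance

namespace PolyFun

/-- The reductions take polynomial time, since all intermediate lists have polynomial size. -/
theorem reduced : PolyFun fun I : latticeInstances k p => I.1.reduced := by
  have hm : PolyBdd fun I : latticeInstances k p => I.1.net.m := polyBdd_card_edges
  have hcap : PolyBdd fun I : latticeInstances k p =>
      esize (∑ i ∈ Finset.range I.1.net.m, I.1.net.scaledCap i) := by
    simp only [Network.sum_scaledCap]
    exact PolyBdd.esize_comp (comp (g := fun L : List EdgeData =>
      (_root_.scaled (fun e => e.2.2.2.1.1) (fun e => e.2.2.2.1.2) L).sum) (by fun_prop) edgeData)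
  have hcost : PolyBdd fun I : latticeInstances k p =>
      esize (∑ i ∈ Finset.range I.1.net.m, I.1.net.scaledCost i) := by
    simp only [Network.sum_scaledCost]
    exact PolyBdd.esize_comp (comp (g := fun L : List EdgeData =>
      (_root_.scaled (fun e => e.2.2.1.1) (fun e => e.2.2.1.2) L).sum) (by fun_prop) edgeData)
  have hN : PolyBdd fun I : latticeInstances k p =>
      (2 * (I.1.net.m * p.eval (esize I)) + 1) ^ k :=
    (((PolyBdd.const 2).mul (hm.mul (PolyBdd.esize.eval p))).add (PolyBdd.const 1)).pow k
  have hn : PolyBdd fun I : latticeInstances k p => esize I.1.net.n :=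
    PolyBdd.esize_comp card_vertices
  have hinit : PolyFun fun I : latticeInstances k p => _root_.initialList I.1.net.edgeData :=
    initialList edgeData
  refine foldl_of_bound (s := fun (I : latticeInstances k p) L _ =>
    _root_.reduceStep I.1.net.s I.1.net.t L) hinit hinit ?_
    ((hm.mul ((((PolyBdd.const 2).mul hn).add ((((hN.pow 4).mul (((((PolyBdd.const 4).mul
      hcap).add hcost).add (hm.mul (hm.add (PolyBdd.const 1)))).add (PolyBdd.const 6)
      |>.add (PolyBdd.const 1)))).add (PolyBdd.const 1))).add (PolyBdd.const 3))).add
      (PolyBdd.const 1)) fun I l₁ l₂ _ => ?_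
  · have h₁ := source.comp (f := fun x : latticeInstances k p × List SuperEdge × SuperEdge => x.1)
      (by fun_prop)
    have h₂ := sink.comp (f := fun x : latticeInstances k p × List SuperEdge × SuperEdge => x.1)
      (by fun_prop)
    exact reduceStep h₁ h₂ (by fun_prop)
  · obtain ⟨h₁, h₂⟩ := Instance.invariant_foldl I.2.1 l₁
    have hpos := Instance.card_edges_pos I.2.1
    exact h₁.esize_le I.1.net.scaledCap_nonneg I.1.net.scaledCost_nonneg (h₂.trans (by omega))
      (card_scaledCap_sums_le I)

theorem root : PolyFun fun I : latticeInstances k p => I.1.root := by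
  unfold Instance.root
  exact list_headD reduced (const _)

theorem flowValue : PolyFun fun x : latticeInstances k p × Row => x.1.1.flowValue x.2 := by
  have h₁ := source.comp (f := fun x : latticeInstances k p × Row => x.1) (by fun_prop)
  have h₂ := sink.comp (f := fun x : latticeInstances k p × Row => x.1) (by fun_prop)
  have h₃ := root.comp (f := fun x : latticeInstances k p × Row => x.1) (by fun_prop)
  exact minSide h₁ h₂ h₃.superEdge_x fun a => minSide h₁ h₂ h₃.superEdge_y fun b => by fun_prop

theorem affordable : PolyFun fun I : latticeInstances k p => I.1.affordable := by
  have h₁ := bound_num.comp (f := fun x : latticeInstances k p × Row => x.1) (by fun_prop)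
  have h₂ := bound_den.comp (f := fun x : latticeInstances k p × Row => x.1) (by fun_prop)
  have h₃ := costDenom.comp (f := fun x : latticeInstances k p × Row => x.1) (by fun_prop)
  exact list_filter root.superEdge_table (by fun_prop)

theorem sufficient : PolyFun fun I : latticeInstances k p => I.1.sufficient := by
  have h₁ := bound_num.comp (f := fun x : latticeInstances k p × Row => x.1) (by fun_prop)
  have h₂ := bound_den.comp (f := fun x : latticeInstances k p × Row => x.1) (by fun_prop)
  have h₃ := capDenom.comp (f := fun x : latticeInstances k p × Row => x.1) (by fun_prop)
  have h₄ := flowValue (k := k) (p := p)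
  exact list_filter root.superEdge_table (by fun_prop)

theorem solveBCMFP : PolyFun fun I : latticeInstances k p => I.1.solveBCMFP :=
  (bestRow flowValue affordable).row_edges

theorem solveCapNDP : PolyFun fun I : latticeInstances k p => I.1.solveCapNDP :=
  cond sufficient.list_isEmpty (const none)
    (bestRow (f := fun _ r => -1 * r.cost) (by fun_prop) sufficient).row_edges.option_some

end PolyFun

theorem PolyTimeSolvable.of_polyFun {C : Set Instance} {β : Type} [Enc β] {f : C → β}
    {Answer : Instance → Val → Prop} (hf : PolyFun f) (h : ∀ I : C, Answer I.1 (enc (f I))) :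
    PolyTimeSolvable C Answer := by
  obtain ⟨P, b, ⟨q, hq⟩, hP⟩ := hf
  refine ⟨P, q, fun I hI => ?_⟩
  obtain ⟨t, ht, htb⟩ := hP ⟨I, hI⟩
  exact ⟨_, t, ht, htb.trans (hq ⟨I, hI⟩), h ⟨I, hI⟩⟩

end

theorem theorem3 (k : ℕ) (p : Polynomial ℕ) :
    PolyTimeSolvable (latticeInstances k p) BCMFPAnswer ∧
      PolyTimeSolvable (latticeInstances k p) CapNDPAnswer :=
  ⟨.of_polyFun PolyFun.solveBCMFP fun I => Instance.solveBCMFP_correct I.2.1,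
    .of_polyFun PolyFun.solveCapNDP fun I => Instance.solveCapNDP_correct I.2.1⟩
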